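/- Let $q\ge 0$, let $a<b$ be real numbers, let $m\ge 0$, and let $s_0,\dots,s_m$ be complex $q\times q$ matrices. Put $\widehat s_j:=-ab\,s_j+(a+b)s_{j+1}-s_{j+2}$ and, for the block matrices with $l,k=0,\dots,j$, $$H_{1,j}:=(s_{l+k}),\quad H_{2,j}:=(\widehat s_{l+k}),\quad K_{1,j}:=(b\,s_{l+k}-s_{l+k+1}),\quad K_{2,j}:=(-a\,s_{l+k}+s_{l+k+1}).$$ Assume that $(s_k)_{k=0}^m$ is a Hausdorff positive definite sequence on $[a,b]$, that is: if $m=2n$, then $H_{1,n}$ and (when $n\ge1$) $H_{2,n-1}$ are positive definite; if $m=2n+1$, then $K_{1,n}$ and $K_{2,n}$ are positive definite. For $j\ge1$ let $Y_{1,j}$, $Y_{2,j}$, $\widetilde Y_{1,j}$, $\widetilde Y_{2,j}$ be the block columns with the $j$ blocks $s_i$, $\widehat s_i$, $b s_i-s_{i+1}$, $-a s_i+s_{i+1}$ $(i=j,\dots,2j-1)$, respectively. The Schur complements are $$\widehat H_{1,0}=s_0,\quad \widehat H_{2,0}=\widehat s_0,\quad \widehat K_{1,0}=b s_0-s_1,\quad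 \widehat K_{2,0}=-as_0+s_1,$$ and, for $j\ge1$, $$\widehat H_{1,j}=s_{2j}-Y_{1,j}^*H_{1,j-1}^{-1}Y_{1,j},\qquad \widehat H_{2,j}=\widehat s_{2j}-Y_{2,j}^*H_{2,j-1}^{-1}Y_{2,j},$$ $$\widehat K_{1,j}=b s_{2j}-s_{2j+1}-\widetilde Y_{1,j}^*K_{1,j-1}^{-1}\widetilde Y_{1,j},\qquad \widehat K_{2,j}=-a s_{2j}+s_{2j+1}-\widetilde Y_{2,j}^*K_{2,j-1}^{-1}\widetilde Y_{2,j}.$$ Let $T_j$ be the $(j+1)\times(j+1)$ block matrix with $I_q$ on the first block subdiagonal and $0$ elsewhere, $R_j(z)=(I-zT_j)^{-1}$, and let $v_j$, $u_{2,j}$, $\widetilde u_{2,j}$ be the block columns $$v_j=(I_q,0,\dots,0),\quad u_{2,j}=(-(a+b)s_0+s_1,-\widehat s_0,\dots,-\widehat s_{j-1}),\quad \widetilde u_{2,j}=(-s_0,-s_1+as_0,\dots,-s_j+as_{j-1}).$$ Put $P_{1,0}=\Gamma_{1,0}=I_q$, $Q_{2,0}(z)=-(u_{2,0}+zs_0)$,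 $\Theta_{2,0}=-s_0$ and, for $j\ge1$, $$P_{1,j}(z)=(-Y_{1,j}^*H_{1,j-1}^{-1},I_q)R_j(z)v_j,\qquad \Gamma_{1,j}(z)=(-\widetilde Y_{1,j}^*K_{1,j-1}^{-1},I_q)R_j(z)v_j,$$ $$Q_{2,j}(z)=-(-Y_{2,j}^*H_{2,j-1}^{-1},I_q)R_j(z)(u_{2,j}+zv_js_0),\qquad \Theta_{2,j}(z)=(-\widetilde Y_{2,j}^*K_{2,j-1}^{-1},I_q)R_j(z)\widetilde u_{2,j}.$$ With $$t_j=v_j^*R_j(a)^*K_{1,j}^{-1}R_j(a)v_j,\qquad g_j=(u_{2,j}^*+as_0v_j^*)R_j(a)^*H_{2,j}^{-1}R_j(a)(u_{2,j}+av_js_0),$$ the Dyukarev–Stieltjes matrix (DSM) parameters are $\mathbf m_0=t_0$, $\mathbf l_0=g_0$, and $\mathbf m_j=t_j-t_{j-1}$, $\mathbf l_j=g_j-g_{j-1}$ for $j\ge1$. Write $\overrightarrow{\prod}_{k=0}^{N}A_k=A_0A_1\cdots A_N$, $\overleftarrow{\prod}_{k=0}^{N}A_k=A_N\cdots A_1A_0$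 (both are $I_q$ for $N=-1$), and $X^{-1*}=(X^{-1})^*$. Then $H_{1,j},\widehat H_{1,j}$ ($2j\le m$), $K_{1,j},K_{2,j},\widehat K_{1,j},\widehat K_{2,j},\mathbf m_j$ ($2j+1\le m$) and $H_{2,j},\widehat H_{2,j},\mathbf l_j$ ($2j+2\le m$) are positive definite, so that all the inverses above and below exist, and the following hold. 1. The Schur complements in terms of the DSM parameters: $$\widehat H_{2,j}=\overrightarrow{\prod_{k=0}^{j}}(\mathbf m_k\mathbf l_k)^{-1*}\;\mathbf l_j\;\overleftarrow{\prod_{k=0}^{j}}(\mathbf m_k\mathbf l_k)^{-1}\quad(2j+2\le m),$$ $$\widehat K_{1,j}=\overrightarrow{\prod_{k=0}^{j-1}}(\mathbf m_k\mathbf l_k)^{-1*}\;\mathbf m_j^{-1}\;\overleftarrow{\prod_{k=0}^{j-1}}(\mathbf m_k\mathbf l_k)^{-1}\quad(2j+1\le m);$$ in particular $\widehat H_{2,0}=(\mathbf m_0\mathbf l_0)^{-1*}\mathbf l_0(\mathbf m_0\mathbf l_0)^{-1}$ and $\widehat K_{1,0}=\mathbf m_0^{-1}$. 2. The values at $a$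 as alternating products of Schur complements: $$P_{1,j}(a)=(-1)^j\overleftarrow{\prod_{k=0}^{j-1}}\widehat K_{2,k}\widehat H_{1,k}^{-1}\quad(2j\le m+1),\qquad \Gamma_{1,j}(a)=(-1)^j\overleftarrow{\prod_{k=0}^{j-1}}\widehat H_{2,k}\widehat K_{1,k}^{-1}\quad(2j\le m),$$ $$Q_{2,j}(a)=(-1)^j\widehat K_{1,j}\overleftarrow{\prod_{k=0}^{j-1}}\widehat H_{2,k}^{-1}\widehat K_{1,k}\quad(2j+1\le m),\qquad \Theta_{2,j}(a)=(-1)^{j+1}\widehat H_{1,j}\overleftarrow{\prod_{k=0}^{j-1}}\widehat K_{2,k}^{-1}\widehat H_{1,k}\quad(2j\le m).$$ 3. The DSM parameters in terms of the Schur complements: $$\mathbf m_j=\overrightarrow{\prod_{k=0}^{j-1}}(\widehat H_{2,k}\widehat K_{1,k}^{-1})^*\;\widehat K_{1,j}^{-1}\;\overleftarrow{\prod_{k=0}^{j-1}}\widehat H_{2,k}\widehat K_{1,k}^{-1}\quad(2j+1\le m),$$ $$\mathbf l_j=\overrightarrow{\prod_{k=0}^{j}}(\widehat H_{2,k}^{-1}\widehat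 K_{1,k})^*\;\widehat H_{2,j}\;\overleftarrow{\prod_{k=0}^{j}}\widehat H_{2,k}^{-1}\widehat K_{1,k}\quad(2j+2\le m);$$ in particular $\mathbf m_0=\widehat K_{1,0}^{-1}$ and $\mathbf l_0=(\widehat H_{2,0}^{-1}\widehat K_{1,0})^*\widehat H_{2,0}(\widehat H_{2,0}^{-1}\widehat K_{1,0})$. -/

import Mathlib

open scoped ComplexOrder Matrix

namespace THMM

noncomputable section

/-- The block Hankel matrix with blocks `f (l + k)`, `0 ≤ l, k ≤ j`. -/
def hankel {q : ℕ} (f : ℕ → Matrix (Fin q) (Fin q) ℂ) (j : ℕ) :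
    Matrix (Fin (j + 1) × Fin q) (Fin (j + 1) × Fin q) ℂ :=
  Matrix.of fun x y => f ((x.1 : ℕ) + (y.1 : ℕ)) x.2 y.2

/-- The block column with the `N` blocks `f 0, …, f (N - 1)`. -/
def blockCol {q : ℕ} (f : ℕ → Matrix (Fin q) (Fin q) ℂ) (N : ℕ) :
    Matrix (Fin N × Fin q) (Fin q) ℂ :=
  Matrix.of fun x c => f (x.1 : ℕ) x.2 c

/-- The block row `(A, I_q)`. -/
def rowI {q j : ℕ} (A : Matrix (Fin q) (Fin j × Fin q) ℂ) :
    Matrix (Fin q) (Fin (j + 1) × Fin q) ℂ :=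
  Matrix.of fun r x =>
    if h : (x.1 : ℕ) < j then A r (⟨x.1, h⟩, x.2) else (1 : Matrix (Fin q) (Fin q) ℂ) r x.2

/-- `ŝ_j = -ab s_j + (a+b) s_{j+1} - s_{j+2}`. -/
def sHat {q : ℕ} (a b : ℝ) (s : ℕ → Matrix (Fin q) (Fin q) ℂ) (j : ℕ) :
    Matrix (Fin q) (Fin q) ℂ :=
  -((a : ℂ) * (b : ℂ)) • s j + ((a : ℂ) + (b : ℂ)) • s (j + 1) - s (j + 2)

/-- `b s_j - s_{j+1}`. -/
def sB {q : ℕ} (b : ℝ) (s : ℕ → Matrix (Fin q) (Fin q) ℂ) (j : ℕ) :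
    Matrix (Fin q) (Fin q) ℂ :=
  (b : ℂ) • s j - s (j + 1)

/-- `-a s_j + s_{j+1}`. -/
def sA {q : ℕ} (a : ℝ) (s : ℕ → Matrix (Fin q) (Fin q) ℂ) (j : ℕ) :
    Matrix (Fin q) (Fin q) ℂ :=
  -(a : ℂ) • s j + s (j + 1)

/-- `H_{1,j}`. -/
def H1 {q : ℕ} (s : ℕ → Matrix (Fin q) (Fin q) ℂ) (j : ℕ) :
    Matrix (Fin (j + 1) × Fin q) (Fin (j + 1) × Fin q) ℂ :=
  hankel s j

/-- `H_{2,j}`. -/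
def H2 {q : ℕ} (a b : ℝ) (s : ℕ → Matrix (Fin q) (Fin q) ℂ) (j : ℕ) :
    Matrix (Fin (j + 1) × Fin q) (Fin (j + 1) × Fin q) ℂ :=
  hankel (sHat a b s) j

/-- `K_{1,j}`. -/
def K1 {q : ℕ} (b : ℝ) (s : ℕ → Matrix (Fin q) (Fin q) ℂ) (j : ℕ) :
    Matrix (Fin (j + 1) × Fin q) (Fin (j + 1) × Fin q) ℂ :=
  hankel (sB b s) j

/-- `K_{2,j}`. -/
def K2 {q : ℕ} (a : ℝ) (s : ℕ → Matrix (Fin q) (Fin q) ℂ) (j : ℕ) :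
    Matrix (Fin (j + 1) × Fin q) (Fin (j + 1) × Fin q) ℂ :=
  hankel (sA a s) j

/-- `(s_k)_{k=0}^m` is a Hausdorff positive definite sequence on `[a,b]`: for `m = 2j` the matrices
`H_{1,j}` and (if `j ≥ 1`) `H_{2,j-1}` are positive definite, for `m = 2j+1` the matrices
`K_{1,j}` and `K_{2,j}` are. Only `s 0, …, s m` enter. -/
def HausdorffPosDef {q : ℕ} (a b : ℝ) (s : ℕ → Matrix (Fin q) (Fin q) ℂ) (m : ℕ) : Prop :=
  (∀ j : ℕ, m = 2 * j → (H1 s j).PosDef ∧ ∀ i : ℕ, j = i + 1 → (H2 a b s i).PosDef) ∧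
  (∀ j : ℕ, m = 2 * j + 1 → (K1 b s j).PosDef ∧ (K2 a s j).PosDef)

/-- `Y_{1,j}`, the column of `s_j, …, s_{2j-1}`. -/
def Y1 {q : ℕ} (s : ℕ → Matrix (Fin q) (Fin q) ℂ) (j : ℕ) : Matrix (Fin j × Fin q) (Fin q) ℂ :=
  blockCol (fun i => s (j + i)) j

/-- `Y_{2,j}`, the column of `ŝ_j, …, ŝ_{2j-1}`. -/
def Y2 {q : ℕ} (a b : ℝ) (s : ℕ → Matrix (Fin q) (Fin q) ℂ) (j : ℕ) :
    Matrix (Fin j × Fin q) (Fin q) ℂ :=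
  blockCol (fun i => sHat a b s (j + i)) j

/-- `Ỹ_{1,j} = b y_{[j,2j-1]} - y_{[j+1,2j]}`. -/
def Yt1 {q : ℕ} (b : ℝ) (s : ℕ → Matrix (Fin q) (Fin q) ℂ) (j : ℕ) :
    Matrix (Fin j × Fin q) (Fin q) ℂ :=
  blockCol (fun i => sB b s (j + i)) j

/-- `Ỹ_{2,j} = -a y_{[j,2j-1]} + y_{[j+1,2j]}`. -/
def Yt2 {q : ℕ} (a : ℝ) (s : ℕ → Matrix (Fin q) (Fin q) ℂ) (j : ℕ) :
    Matrix (Fin j × Fin q) (Fin q) ℂ :=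
  blockCol (fun i => sA a s (j + i)) j

/-- The Schur complement `Ĥ_{1,j}`. -/
def hatH1 {q : ℕ} (s : ℕ → Matrix (Fin q) (Fin q) ℂ) : ℕ → Matrix (Fin q) (Fin q) ℂ
  | 0 => s 0
  | j + 1 => s (2 * (j + 1)) - (Y1 s (j + 1))ᴴ * (H1 s j)⁻¹ * Y1 s (j + 1)

/-- The Schur complement `Ĥ_{2,j}`. -/
def hatH2 {q : ℕ} (a b : ℝ) (s : ℕ → Matrix (Fin q) (Fin q) ℂ) : ℕ → Matrix (Fin q) (Fin q) ℂ
  | 0 => sHat a b s 0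
  | j + 1 => sHat a b s (2 * (j + 1)) -
      (Y2 a b s (j + 1))ᴴ * (H2 a b s j)⁻¹ * Y2 a b s (j + 1)

/-- The Schur complement `K̂_{1,j}`. -/
def hatK1 {q : ℕ} (b : ℝ) (s : ℕ → Matrix (Fin q) (Fin q) ℂ) : ℕ → Matrix (Fin q) (Fin q) ℂ
  | 0 => sB b s 0
  | j + 1 => sB b s (2 * (j + 1)) - (Yt1 b s (j + 1))ᴴ * (K1 b s j)⁻¹ * Yt1 b s (j + 1)

/-- The Schur complement `K̂_{2,j}`. -/
def hatK2 {q : ℕ} (a : ℝ) (s : ℕ → Matrix (Fin q) (Fin q) ℂ) : ℕ → Matrix (Fin q) (Fin q) ℂ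
  | 0 => sA a s 0
  | j + 1 => sA a s (2 * (j + 1)) - (Yt2 a s (j + 1))ᴴ * (K2 a s j)⁻¹ * Yt2 a s (j + 1)

/-- The block shift `T_j`, with `I_q` on the first block subdiagonal (`T_0 = 0`). -/
def T (q j : ℕ) : Matrix (Fin (j + 1) × Fin q) (Fin (j + 1) × Fin q) ℂ :=
  Matrix.of fun x y => if (x.1 : ℕ) = (y.1 : ℕ) + 1 ∧ x.2 = y.2 then 1 else 0

/-- `R_j(z) = (I - z T_j)⁻¹`. -/
def R (q j : ℕ) (z : ℂ) : Matrix (Fin (j + 1) × Fin q) (Fin (j + 1) × Fin q) ℂ :=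
  (1 - z • T q j)⁻¹

/-- `v_j`, the block column `(I_q, 0, …, 0)`. -/
def v (q j : ℕ) : Matrix (Fin (j + 1) × Fin q) (Fin q) ℂ :=
  blockCol (fun i => if i = 0 then 1 else 0) (j + 1)

/-- `u_{2,j}`, the block column `(-(a+b) s_0 + s_1, -ŝ_0, …, -ŝ_{j-1})`. -/
def u2 {q : ℕ} (a b : ℝ) (s : ℕ → Matrix (Fin q) (Fin q) ℂ) (j : ℕ) :
    Matrix (Fin (j + 1) × Fin q) (Fin q) ℂ :=
  blockCol (fun i =>
    if i = 0 then -((a : ℂ) + (b : ℂ)) • s 0 + s 1 else -sHat a b s (i - 1)) (j + 1)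

/-- `ũ_{2,j}`, the block column `(-s_0, -s_1 + a s_0, …, -s_j + a s_{j-1})`. -/
def ut2 {q : ℕ} (a : ℝ) (s : ℕ → Matrix (Fin q) (Fin q) ℂ) (j : ℕ) :
    Matrix (Fin (j + 1) × Fin q) (Fin q) ℂ :=
  blockCol (fun i => if i = 0 then -s 0 else -s i + (a : ℂ) • s (i - 1)) (j + 1)

/-- The matrix polynomial `P_{1,j}`. -/
def P1 {q : ℕ} (s : ℕ → Matrix (Fin q) (Fin q) ℂ) : ℕ → ℂ → Matrix (Fin q) (Fin q) ℂ
  | 0, _ => 1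
  | j + 1, z => rowI (-((Y1 s (j + 1))ᴴ * (H1 s j)⁻¹)) * R q (j + 1) z * v q (j + 1)

/-- The matrix polynomial `Q_{2,j}`. -/
def Q2 {q : ℕ} (a b : ℝ) (s : ℕ → Matrix (Fin q) (Fin q) ℂ) :
    ℕ → ℂ → Matrix (Fin q) (Fin q) ℂ
  | 0, z => -((-((a : ℂ) + (b : ℂ)) • s 0 + s 1) + z • s 0)
  | j + 1, z => -(rowI (-((Y2 a b s (j + 1))ᴴ * (H2 a b s j)⁻¹)) * R q (j + 1) z *
      (u2 a b s (j + 1) + z • (v q (j + 1) * s 0)))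

/-- The matrix polynomial `Γ_{1,j}`. -/
def Gamma1 {q : ℕ} (b : ℝ) (s : ℕ → Matrix (Fin q) (Fin q) ℂ) :
    ℕ → ℂ → Matrix (Fin q) (Fin q) ℂ
  | 0, _ => 1
  | j + 1, z => rowI (-((Yt1 b s (j + 1))ᴴ * (K1 b s j)⁻¹)) * R q (j + 1) z * v q (j + 1)

/-- The matrix polynomial `Θ_{2,j}`. -/
def Theta2 {q : ℕ} (a : ℝ) (s : ℕ → Matrix (Fin q) (Fin q) ℂ) :
    ℕ → ℂ → Matrix (Fin q) (Fin q) ℂ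
  | 0, _ => -s 0
  | j + 1, z => rowI (-((Yt2 a s (j + 1))ᴴ * (K2 a s j)⁻¹)) * R q (j + 1) z * ut2 a s (j + 1)

/-- `v_j^* R_j(a)^* K_{1,j}⁻¹ R_j(a) v_j`. -/
def dsmT {q : ℕ} (a b : ℝ) (s : ℕ → Matrix (Fin q) (Fin q) ℂ) (j : ℕ) :
    Matrix (Fin q) (Fin q) ℂ :=
  (v q j)ᴴ * (R q j a)ᴴ * (K1 b s j)⁻¹ * R q j a * v q j

/-- `(u_{2,j}^* + a s_0 v_j^*) R_j(a)^* H_{2,j}⁻¹ R_j(a) (u_{2,j} + a v_j s_0)`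
(for `j = 0` the factors `R_0(a)` are the identity). -/
def dsmG {q : ℕ} (a b : ℝ) (s : ℕ → Matrix (Fin q) (Fin q) ℂ) (j : ℕ) :
    Matrix (Fin q) (Fin q) ℂ :=
  ((u2 a b s j)ᴴ + (a : ℂ) • (s 0 * (v q j)ᴴ)) * (R q j a)ᴴ * (H2 a b s j)⁻¹ * R q j a *
    (u2 a b s j + (a : ℂ) • (v q j * s 0))

/-- The Dyukarev–Stieltjes matrix parameter `𝐦_j`. -/
def dsmM {q : ℕ} (a b : ℝ) (s : ℕ → Matrix (Fin q) (Fin q) ℂ) : ℕ → Matrix (Fin q) (Fin q) ℂ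
  | 0 => dsmT a b s 0
  | j + 1 => dsmT a b s (j + 1) - dsmT a b s j

/-- The Dyukarev–Stieltjes matrix parameter `𝐥_j`. -/
def dsmL {q : ℕ} (a b : ℝ) (s : ℕ → Matrix (Fin q) (Fin q) ℂ) : ℕ → Matrix (Fin q) (Fin q) ℂ
  | 0 => dsmG a b s 0
  | j + 1 => dsmG a b s (j + 1) - dsmG a b s j

/-- The right product `A_0 A_1 ⋯ A_{N-1}` of `N` factors (`I_q` for `N = 0`). -/
def prodRight {q : ℕ} (A : ℕ → Matrix (Fin q) (Fin q) ℂ) (N : ℕ) : Matrix (Fin q) (Fin q) ℂ :=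
  ((List.range N).map A).prod

/-- The left product `A_{N-1} ⋯ A_1 A_0` of `N` factors (`I_q` for `N = 0`). -/
def prodLeft {q : ℕ} (A : ℕ → Matrix (Fin q) (Fin q) ℂ) (N : ℕ) : Matrix (Fin q) (Fin q) ℂ :=
  ((List.range N).reverse.map A).prod

end

end THMM

/-! Everything reduces to monic left orthogonal matrix polynomials. For moments `f`, the block row
`(-Y^* H⁻¹, I)` lists the coefficients of the monic polynomial `orthPoly f j` of degree `j`
orthogonal to all lower degrees, and its pairing with the `j`-th shift of `f` is the Schur
complement `schur f j`. `P1` and `Gamma1` are values of such polynomials. At `z = a` the resolvent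
turns `Theta2` (up to sign) and `Q2` into pairings of the polynomials of `sA a s` and `sHat a b s`
with `s` and `sB b s`.

Since `sHat a b s = sA a (sB b s)`, it suffices to compare `f` with `sA a f`, that is, to multiply
the weight by `x - a`. Christoffel's formula `orthPoly_succ` loses its first term on evaluation at
`a`; the kernel relation `orthPoly_sA_succ` loses its first term on pairing with `f`. Both become
two-term recurrences, whose iteration gives the alternating products.

Enlarging a Hankel matrix by one block adds a single term to the quadratic form of its inverse
(`quadratic_inv_gram_succ`). Hence `𝐦_j = Γ^* K̂⁻¹ Γ` and `𝐥_j = Q^* Ĥ⁻¹ Q` at `a`, which expresses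
the parameters through Schur complements. If `Ψ_k` is the left product of the first `k` factors
`Ĥ_2⁻¹ K̂_1`, then `𝐦_k 𝐥_k = Ψ_k⁻¹ Ψ_{k+1}`; the telescoping product inverts these formulas. -/

namespace THMM

open Polynomial

noncomputable section

/-! ### Block matrices of arbitrary size -/

/-- The block Hankel matrix with `N` block rows, which may be empty. -/
def gram {q : ℕ} (f : ℕ → Matrix (Fin q) (Fin q) ℂ) (N : ℕ) :
    Matrix (Fin N × Fin q) (Fin N × Fin q) ℂ :=
  Matrix.of fun x y => f ((x.1 : ℕ) + (y.1 : ℕ)) x.2 y.2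

/-- The `i`-th block of a block row. -/
def rowBlock {q N : ℕ} (A : Matrix (Fin q) (Fin N × Fin q) ℂ) (i : Fin N) :
    Matrix (Fin q) (Fin q) ℂ :=
  Matrix.of fun r c => A r (i, c)

lemma row_mul_blockCol {q N : ℕ} (A : Matrix (Fin q) (Fin N × Fin q) ℂ)
    (e : ℕ → Matrix (Fin q) (Fin q) ℂ) :
    A * blockCol e N = ∑ i : Fin N, rowBlock A i * e i := by
  ext r c
  simp [Matrix.mul_apply, Matrix.sum_apply, Fintype.sum_prod_type, blockCol, rowBlock]

lemma rowBlock_mul_gram {q N : ℕ} (A : Matrix (Fin q) (Fin N × Fin q) ℂ)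
    (f : ℕ → Matrix (Fin q) (Fin q) ℂ) (k : Fin N) :
    rowBlock (A * gram f N) k = A * blockCol (fun i => f (i + k)) N := by
  ext r c
  simp [Matrix.mul_apply, blockCol, rowBlock, gram]

lemma rowBlock_ext {q N : ℕ} {A B : Matrix (Fin q) (Fin N × Fin q) ℂ}
    (h : ∀ k, rowBlock A k = rowBlock B k) : A = B := by
  ext r ⟨k, c⟩
  exact congrFun (congrFun (h k) r) c

lemma rowI_mul_blockCol {q j : ℕ} (A : Matrix (Fin q) (Fin j × Fin q) ℂ)
    (e : ℕ → Matrix (Fin q) (Fin q) ℂ) :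
    rowI A * blockCol e (j + 1) = A * blockCol e j + e j := by
  rw [row_mul_blockCol, row_mul_blockCol, Fin.sum_univ_castSucc]
  congr 1
  · refine Finset.sum_congr rfl fun i _ => ?_
    congr 1
    ext r c
    simp [rowBlock, rowI]
  · have : rowBlock (rowI A) (Fin.last j) = 1 := by
      ext r c
      simp [rowBlock, rowI]
    simp [this]

lemma gram_isHermitian_block {q N : ℕ} {f : ℕ → Matrix (Fin q) (Fin q) ℂ}
    (h : (gram f N).IsHermitian) (i k : Fin N) : (f (i + k)).IsHermitian := by
  ext r c
  have := congrFun (congrFun h (i, r)) (k, c)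
  simp only [Matrix.conjTranspose_apply, gram, Matrix.of_apply] at this ⊢
  rw [← this, add_comm]

/-! ### Pairing of matrix polynomials with sequences -/

/-- `∑ cᵢ eᵢ` for the polynomial `∑ cᵢ Xⁱ`. -/
def pair {q : ℕ} (e : ℕ → Matrix (Fin q) (Fin q) ℂ) :
    (Matrix (Fin q) (Fin q) ℂ)[X] →ₗ[Matrix (Fin q) (Fin q) ℂ] Matrix (Fin q) (Fin q) ℂ :=
  Polynomial.lsum fun i => LinearMap.toSpanSingleton _ _ (e i)

lemma pair_eq_sum {q : ℕ} (e : ℕ → Matrix (Fin q) (Fin q) ℂ) (p : (Matrix (Fin q) (Fin q) ℂ)[X]) :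
    pair e p = p.sum fun i c => c * e i := rfl

@[simp] lemma pair_monomial {q : ℕ} (e : ℕ → Matrix (Fin q) (Fin q) ℂ) (n : ℕ)
    (c : Matrix (Fin q) (Fin q) ℂ) : pair e (monomial n c) = c * e n := by
  rw [pair_eq_sum, sum_monomial_index _ _ (by simp)]

lemma pair_mul_X {q : ℕ} (e : ℕ → Matrix (Fin q) (Fin q) ℂ) (p : (Matrix (Fin q) (Fin q) ℂ)[X]) :
    pair e (p * X) = pair (fun i => e (i + 1)) p := by
  induction p using Polynomial.induction_on' with
  | add p r hp hr => rw [add_mul, map_add, map_add, hp, hr]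
  | monomial n c => simp [monomial_mul_X]

lemma pair_smul_add {q : ℕ} (e e' : ℕ → Matrix (Fin q) (Fin q) ℂ) (x : ℂ)
    (p : (Matrix (Fin q) (Fin q) ℂ)[X]) :
    pair (fun i => x • e i + e' i) p = x • pair e p + pair e' p := by
  induction p using Polynomial.induction_on' with
  | add p r hp hr => rw [map_add, map_add, map_add, hp, hr, smul_add]; abel
  | monomial n c => simp [mul_add]

/-- Multiplication by `X - α`. -/
def mulXSub {q : ℕ} (α : ℂ) (p : (Matrix (Fin q) (Fin q) ℂ)[X]) :
    (Matrix (Fin q) (Fin q) ℂ)[X] :=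
  p * X - (α • (1 : Matrix (Fin q) (Fin q) ℂ)) • p

/-- `X - α` commutes with the matrix coefficients, so it can be moved onto the moments. For `α = a`
these become `sA a e`. -/
lemma pair_mulXSub {q : ℕ} (e : ℕ → Matrix (Fin q) (Fin q) ℂ) (α : ℂ)
    (p : (Matrix (Fin q) (Fin q) ℂ)[X]) :
    pair e (mulXSub α p) = pair (fun i => -α • e i + e (i + 1)) p := by
  rw [mulXSub, map_sub, map_smul, pair_mul_X, pair_smul_add]
  simp only [smul_eq_mul, Matrix.smul_mul, one_mul, neg_smul]
  abel

/-- The vanishing pairings say that the coefficient row times the invertible Hankel matrix is zero.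
-/
lemma pair_eq_zero_unique {q N : ℕ} {f : ℕ → Matrix (Fin q) (Fin q) ℂ}
    (hf : IsUnit (gram f N)) {p : (Matrix (Fin q) (Fin q) ℂ)[X]} (hp : p.degree < (N : WithBot ℕ))
    (h : ∀ k < N, pair (fun i => f (i + k)) p = 0) : p = 0 := by
  let A : Matrix (Fin q) (Fin N × Fin q) ℂ := Matrix.of fun r x => p.coeff x.1 r x.2
  have hA : ∀ i, rowBlock A i = p.coeff i := fun i => rfl
  have h0 : A * gram f N = 0 := by
    refine rowBlock_ext fun k => ?_
    rw [rowBlock_mul_gram, row_mul_blockCol]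
    have := h k k.2
    rw [pair_eq_sum, ← Polynomial.sum_fin _ (by simp) hp] at this
    simpa only [hA] using this.trans (by rfl)
  have hA0 : A = 0 := by
    have := congrArg (· * (gram f N)⁻¹) h0
    simpa [Matrix.mul_assoc, Matrix.mul_nonsing_inv _ ((Matrix.isUnit_iff_isUnit_det _).1 hf)]
      using this
  ext1 n
  by_cases hn : n < N
  · have := hA ⟨n, hn⟩
    rw [hA0] at this
    exact this.symm
  · exact coeff_eq_zero_of_degree_lt (hp.trans_le (by exact_mod_cast not_lt.1 hn))

/-! ### Monic orthogonal matrix polynomials -/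

/-- The row `-Y^* H⁻¹` of the lower coefficients of the monic orthogonal polynomial. -/
def orthRow {q : ℕ} (f : ℕ → Matrix (Fin q) (Fin q) ℂ) (j : ℕ) :
    Matrix (Fin q) (Fin j × Fin q) ℂ :=
  -((blockCol (fun i => f (j + i)) j)ᴴ * (gram f j)⁻¹)

/-- The Schur complement of `gram f j` in `gram f (j + 1)`. -/
def schur {q : ℕ} (f : ℕ → Matrix (Fin q) (Fin q) ℂ) (j : ℕ) : Matrix (Fin q) (Fin q) ℂ :=
  f (2 * j) - (blockCol (fun i => f (j + i)) j)ᴴ * (gram f j)⁻¹ * blockCol (fun i => f (j + i)) j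

/-- The monic left orthogonal polynomial of degree `j` for the moments `f`. -/
def orthPoly {q : ℕ} (f : ℕ → Matrix (Fin q) (Fin q) ℂ) (j : ℕ) :
    (Matrix (Fin q) (Fin q) ℂ)[X] :=
  ∑ i : Fin j, monomial i (rowBlock (orthRow f j) i) + monomial j 1

/-- The empty matrix `gram f 0` makes index zero an instance of the general formula, so the separate
initial cases in the definitions disappear. -/
lemma schur_zero {q : ℕ} (f : ℕ → Matrix (Fin q) (Fin q) ℂ) : schur f 0 = f 0 := by
  ext r c
  simp [schur, Matrix.mul_apply]

lemma orthPoly_zero {q : ℕ} (f : ℕ → Matrix (Fin q) (Fin q) ℂ) : orthPoly f 0 = monomial 0 1 := by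
  simp [orthPoly]

lemma pair_orthPoly {q : ℕ} (e f : ℕ → Matrix (Fin q) (Fin q) ℂ) (j : ℕ) :
    pair e (orthPoly f j) = orthRow f j * blockCol e j + e j := by
  rw [orthPoly, map_add, map_sum, row_mul_blockCol]
  simp

lemma pair_orthPoly_eq_rowI {q : ℕ} (e f : ℕ → Matrix (Fin q) (Fin q) ℂ) (j : ℕ) :
    pair e (orthPoly f j) = rowI (orthRow f j) * blockCol e (j + 1) := by
  rw [pair_orthPoly, rowI_mul_blockCol]

lemma pair_orthPoly_top {q : ℕ} (f : ℕ → Matrix (Fin q) (Fin q) ℂ) (j : ℕ) :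
    pair (fun i => f (i + j)) (orthPoly f j) = schur f j := by
  rw [pair_orthPoly, orthRow, schur, two_mul, Matrix.neg_mul, neg_add_eq_sub]
  simp only [add_comm]

/-- Multiplying `-Y^* H⁻¹` by `H` leaves `-Y^*`. Its blocks are adjoints of moments, so Hermitian
moments are needed for the cancellation against the leading term. -/
lemma pair_orthPoly_lt {q j : ℕ} {f : ℕ → Matrix (Fin q) (Fin q) ℂ} (hf : IsUnit (gram f j))
    (hH : ∀ i < 2 * j, (f i).IsHermitian) {k : ℕ} (hk : k < j) :
    pair (fun i => f (i + k)) (orthPoly f j) = 0 := by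
  rw [pair_orthPoly, ← rowBlock_mul_gram (orthRow f j) f ⟨k, hk⟩, orthRow, Matrix.neg_mul,
    Matrix.mul_assoc, Matrix.nonsing_inv_mul _ ((Matrix.isUnit_iff_isUnit_det _).1 hf)]
  ext r c
  have : (starRingEnd ℂ) (f (j + k) c r) = f (j + k) r c :=
    congrFun (congrFun (hH (j + k) (by omega)) r) c
  simp [rowBlock, blockCol, this]

lemma degree_orthPoly_sub_lt {q : ℕ} (f : ℕ → Matrix (Fin q) (Fin q) ℂ) (j : ℕ) :
    (orthPoly f j - monomial j 1).degree < (j : WithBot ℕ) := by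
  rw [orthPoly, add_sub_cancel_right]
  refine (Polynomial.degree_sum_le _ _).trans_lt ?_
  refine (Finset.sup_lt_iff (WithBot.bot_lt_coe j)).2 fun i _ => ?_
  exact (degree_monomial_le _ _).trans_lt (Nat.cast_lt.2 i.2)

/-- Two monic candidates differ by a polynomial of degree below `j` with zero pairings. Monicity is
phrased through `p - monomial j 1` so that it also makes sense over the trivial ring at `q = 0`. -/
lemma eq_orthPoly {q j : ℕ} {f : ℕ → Matrix (Fin q) (Fin q) ℂ} (hf : IsUnit (gram f j))
    (hH : ∀ i < 2 * j, (f i).IsHermitian) {p : (Matrix (Fin q) (Fin q) ℂ)[X]}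
    (hp : (p - monomial j 1).degree < (j : WithBot ℕ)) (h : ∀ k < j, pair (fun i => f (i + k)) p = 0) :
    p = orthPoly f j := by
  refine sub_eq_zero.1 (pair_eq_zero_unique hf ?_ fun k hk => ?_)
  · have : p - orthPoly f j = (p - monomial j 1) - (orthPoly f j - monomial j 1) := by abel
    rw [this]
    exact (degree_sub_le _ _).trans_lt (max_lt hp (degree_orthPoly_sub_lt f j))
  · rw [map_sub, h k hk, pair_orthPoly_lt hf hH hk, sub_zero]

lemma degree_orthPoly_lt {q : ℕ} (f : ℕ → Matrix (Fin q) (Fin q) ℂ) (j : ℕ) :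
    (orthPoly f j).degree < ((j + 1 : ℕ) : WithBot ℕ) := by
  have : orthPoly f j = (orthPoly f j - monomial j 1) + monomial j 1 := by abel
  rw [this]
  refine (degree_add_le _ _).trans_lt (max_lt ((degree_orthPoly_sub_lt f j).trans ?_)
    ((degree_monomial_le _ _).trans_lt ?_)) <;> exact_mod_cast Nat.lt_succ_self j

lemma degree_smul_lt {q : ℕ} (c : Matrix (Fin q) (Fin q) ℂ) {p : (Matrix (Fin q) (Fin q) ℂ)[X]}
    {N : ℕ} (hp : p.degree < (N : WithBot ℕ)) : (c • p).degree < (N : WithBot ℕ) :=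
  (degree_smul_le c p).trans_lt hp

lemma isHermitian_sA {q : ℕ} {f : ℕ → Matrix (Fin q) (Fin q) ℂ} (a : ℝ) {i : ℕ}
    (h0 : (f i).IsHermitian) (h1 : (f (i + 1)).IsHermitian) : (sA a f i).IsHermitian := by
  unfold Matrix.IsHermitian at *
  simp [sA, h0, h1]

lemma isHermitian_sB {q : ℕ} {f : ℕ → Matrix (Fin q) (Fin q) ℂ} (b : ℝ) {i : ℕ}
    (h0 : (f i).IsHermitian) (h1 : (f (i + 1)).IsHermitian) : (sB b f i).IsHermitian := by
  unfold Matrix.IsHermitian at *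
  simp [sB, h0, h1]

/-! ### Relations between the orthogonal polynomials of `f` and of `sA a f`. -/

lemma sA_shift {q : ℕ} (a : ℝ) (f : ℕ → Matrix (Fin q) (Fin q) ℂ) (k : ℕ) :
    (fun i => sA a f (i + k)) = fun i => -(a : ℂ) • f (i + k) + f (i + 1 + k) := by
  funext i
  rw [sA, add_right_comm]

/-- Christoffel's formula for the moments `sA a f`. -/
lemma orthPoly_succ {q j : ℕ} (a : ℝ) {f : ℕ → Matrix (Fin q) (Fin q) ℂ}
    (hf : IsUnit (gram f j)) (hf' : IsUnit (gram f (j + 1))) (hg : IsUnit (gram (sA a f) j))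
    (hs : IsUnit (schur f j)) (hH : ∀ i < 2 * j + 2, (f i).IsHermitian) :
    orthPoly f (j + 1) = mulXSub a (orthPoly (sA a f) j) -
      (schur (sA a f) j * (schur f j)⁻¹) • orthPoly f j := by
  symm
  refine eq_orthPoly hf' (fun i hi => hH i (by omega)) ?_ fun k hk => ?_
  · have : mulXSub a (orthPoly (sA a f) j) - (schur (sA a f) j * (schur f j)⁻¹) • orthPoly f j -
        monomial (j + 1) 1 = (orthPoly (sA a f) j - monomial j 1) * X -
        ((a : ℂ) • (1 : Matrix (Fin q) (Fin q) ℂ)) • orthPoly (sA a f) j -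
        (schur (sA a f) j * (schur f j)⁻¹) • orthPoly f j := by
      rw [mulXSub, sub_mul, monomial_mul_X]
      abel
    rw [this]
    refine (degree_sub_le _ _).trans_lt (max_lt ((degree_sub_le _ _).trans_lt (max_lt ?_ ?_)) ?_)
    · refine (degree_mul_le _ _).trans_lt ?_
      have h1 := degree_orthPoly_sub_lt (sA a f) j
      generalize (orthPoly (sA a f) j - monomial j 1).degree = d at h1
      cases d with
      | bot => exact WithBot.bot_lt_coe _
      | coe d =>
        have : ((d : ℕ) : WithBot ℕ) + 1 < ((j + 1 : ℕ) : WithBot ℕ) := by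
          have : d < j := WithBot.coe_lt_coe.1 h1
          exact_mod_cast Nat.succ_lt_succ this
        refine lt_of_le_of_lt ?_ this
        exact add_le_add le_rfl degree_X_le
    · exact degree_smul_lt _ (degree_orthPoly_lt _ _)
    · exact degree_smul_lt _ (degree_orthPoly_lt _ _)
  · rw [map_sub, map_smul, pair_mulXSub, ← sA_shift]
    -- Below `j` both terms vanish by orthogonality; at `k = j` they produce the two Schur
    -- complements, which dictates the coefficient.
    rcases Nat.lt_succ_iff_lt_or_eq.1 hk with hk | rfl
    · rw [pair_orthPoly_lt hf (fun i hi => hH i (by omega)) hk, pair_orthPoly_lt hg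
        (fun i hi => isHermitian_sA a (hH _ (by omega)) (hH _ (by omega))) hk]
      simp
    · rw [pair_orthPoly_top, pair_orthPoly_top, smul_eq_mul, Matrix.mul_assoc,
        Matrix.nonsing_inv_mul _ ((Matrix.isUnit_iff_isUnit_det _).1 hs), mul_one, sub_self]

/-- The kernel relation converse to Christoffel's formula. -/
lemma orthPoly_sA_succ {q j : ℕ} (a : ℝ) {f : ℕ → Matrix (Fin q) (Fin q) ℂ}
    (hf' : IsUnit (gram f (j + 1))) (hg : IsUnit (gram (sA a f) j))
    (hg' : IsUnit (gram (sA a f) (j + 1)))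
    (hs : IsUnit (schur (sA a f) j)) (hH : ∀ i < 2 * j + 3, (f i).IsHermitian) :
    orthPoly (sA a f) (j + 1) = orthPoly f (j + 1) -
      (schur f (j + 1) * (schur (sA a f) j)⁻¹) • orthPoly (sA a f) j := by
  symm
  have hgH : ∀ i < 2 * j + 2, (sA a f i).IsHermitian := fun i hi =>
    isHermitian_sA a (hH _ (by omega)) (hH _ (by omega))
  refine eq_orthPoly hg' (fun i hi => hgH i (by omega)) ?_ fun k hk => ?_
  · rw [sub_right_comm]
    exact (degree_sub_le _ _).trans_lt (max_lt (degree_orthPoly_sub_lt _ _)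
      (degree_smul_lt _ (degree_orthPoly_lt _ _)))
  -- Of the two terms of `sA a f`, the one with factor `-a` pairs to zero since `k < j + 1`; only
  -- the shift by `k + 1` survives.
  · have key : pair (fun i => sA a f (i + k)) (orthPoly f (j + 1)) =
        pair (fun i => f (i + (k + 1))) (orthPoly f (j + 1)) := by
      simp only [sA_shift, pair_smul_add, pair_orthPoly_lt hf' (fun i hi => hH i (by omega)) hk,
        smul_zero, zero_add]
      congr 2
      funext i
      rw [add_right_comm, add_assoc]
    rw [map_sub, map_smul, key]
    rcases Nat.lt_succ_iff_lt_or_eq.1 hk with hk | rfl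
    · rw [pair_orthPoly_lt hf' (fun i hi => hH i (by omega)) (by omega), pair_orthPoly_lt hg
        (fun i hi => hgH i (by omega)) hk]
      simp
    · rw [pair_orthPoly_top, pair_orthPoly_top, smul_eq_mul, Matrix.mul_assoc,
        Matrix.nonsing_inv_mul _ ((Matrix.isUnit_iff_isUnit_det _).1 hs), mul_one, sub_self]

/-- Evaluation at `a` of the orthogonal polynomials. -/
lemma pair_pow_orthPoly_succ {q j : ℕ} (a : ℝ) {f : ℕ → Matrix (Fin q) (Fin q) ℂ}
    (hf : IsUnit (gram f j)) (hf' : IsUnit (gram f (j + 1))) (hg : IsUnit (gram (sA a f) j))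
    (hs : IsUnit (schur f j)) (hH : ∀ i < 2 * j + 2, (f i).IsHermitian) :
    pair (fun i => (a : ℂ) ^ i • 1) (orthPoly f (j + 1)) =
      -(schur (sA a f) j * (schur f j)⁻¹ * pair (fun i => (a : ℂ) ^ i • 1) (orthPoly f j)) := by
  -- Evaluation at `a` annihilates multiples of `X - a`: the transformed sequence of powers is zero.
  have h0 : (fun i => -(a : ℂ) • (a : ℂ) ^ i • (1 : Matrix (Fin q) (Fin q) ℂ) +
      (a : ℂ) ^ (i + 1) • 1) = fun i => (0 : ℂ) • (1 : Matrix (Fin q) (Fin q) ℂ) + 0 := by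
    funext i
    rw [smul_smul, ← add_smul, pow_succ]
    simp [mul_comm]
  rw [orthPoly_succ a hf hf' hg hs hH, map_sub, map_smul, pair_mulXSub, h0]
  rw [pair_eq_sum]
  simp [Polynomial.sum_def]

lemma pair_orthPoly_sA_succ {q j : ℕ} (a : ℝ) {f : ℕ → Matrix (Fin q) (Fin q) ℂ}
    (hf' : IsUnit (gram f (j + 1))) (hg : IsUnit (gram (sA a f) j))
    (hg' : IsUnit (gram (sA a f) (j + 1)))
    (hs : IsUnit (schur (sA a f) j)) (hH : ∀ i < 2 * j + 3, (f i).IsHermitian) :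
    pair f (orthPoly (sA a f) (j + 1)) =
      -(schur f (j + 1) * (schur (sA a f) j)⁻¹ * pair f (orthPoly (sA a f) j)) := by
  have h0 : pair f (orthPoly f (j + 1)) = 0 :=
    pair_orthPoly_lt (k := 0) hf' (fun i hi => hH i (by omega)) (Nat.succ_pos j)
  rw [orthPoly_sA_succ a hf' hg hg' hs hH, map_sub, map_smul, h0, zero_sub, smul_eq_mul]

end

end THMM

namespace THMM

noncomputable section

/-! ### Schur complements and quadratic forms of inverses -/

lemma isUnit_of_posDef {n : Type*} [Fintype n] [DecidableEq n] {M : Matrix n n ℂ}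
    (h : M.PosDef) : IsUnit M.det :=
  (Matrix.isUnit_iff_isUnit_det _).1 h.isUnit

section Blocks

open Matrix

variable {m n k : Type*} [Fintype m] [Fintype n] [DecidableEq m] [DecidableEq n]

lemma inv_fromBlocks_eq {A : Matrix m m ℂ} {Y : Matrix m n ℂ} {D : Matrix n n ℂ}
    (hA : IsUnit A.det) (hS : IsUnit (D - Yᴴ * A⁻¹ * Y).det) :
    (fromBlocks A Y Yᴴ D)⁻¹ =
      fromBlocks (A⁻¹ + A⁻¹ * Y * (D - Yᴴ * A⁻¹ * Y)⁻¹ * Yᴴ * A⁻¹)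
        (-(A⁻¹ * Y * (D - Yᴴ * A⁻¹ * Y)⁻¹)) (-((D - Yᴴ * A⁻¹ * Y)⁻¹ * Yᴴ * A⁻¹))
        (D - Yᴴ * A⁻¹ * Y)⁻¹ := by
  let := invertibleOfIsUnitDet A hA
  let i2 : Invertible (D - Yᴴ * ⅟A * Y) := by
    rw [invOf_eq_nonsing_inv]
    exact invertibleOfIsUnitDet _ hS
  let := fromBlocks₁₁Invertible A Y Yᴴ D
  have h := invOf_fromBlocks₁₁_eq A Y Yᴴ D
  simpa only [invOf_eq_nonsing_inv] using h

/-- Block elimination splits the form into the old one and one new term. The vector in the new term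
is `(-Y^* A⁻¹, I)` applied to the column, which for Hankel matrices is a pairing with `orthPoly`. -/
lemma quadratic_inv_fromBlocks {A : Matrix m m ℂ} {Y : Matrix m n ℂ} {D : Matrix n n ℂ}
    (hA : A.PosDef) (hS : IsUnit (D - Yᴴ * A⁻¹ * Y).det) (x : Matrix m k ℂ) (y : Matrix n k ℂ) :
    (fromRows x y)ᴴ * (fromBlocks A Y Yᴴ D)⁻¹ * fromRows x y =
      xᴴ * A⁻¹ * x + (-(Yᴴ * A⁻¹) * x + y)ᴴ * (D - Yᴴ * A⁻¹ * Y)⁻¹ * (-(Yᴴ * A⁻¹) * x + y) := by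
  have hAi : (A⁻¹)ᴴ = A⁻¹ := hA.isHermitian.inv
  rw [inv_fromBlocks_eq (isUnit_of_posDef hA) hS]
  simp only [conjTranspose_fromRows_eq_fromCols_conjTranspose, fromCols_mul_fromBlocks,
    fromCols_mul_fromRows, conjTranspose_add, conjTranspose_mul, conjTranspose_neg,
    conjTranspose_conjTranspose, hAi, Matrix.mul_add, Matrix.add_mul, Matrix.neg_mul,
    Matrix.mul_neg, Matrix.mul_assoc]
  abel

lemma posDef_schurComplement {A : Matrix m m ℂ} {Y : Matrix m n ℂ} {D : Matrix n n ℂ}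
    (h : (fromBlocks A Y Yᴴ D).PosDef) : (D - Yᴴ * A⁻¹ * Y).PosDef := by
  have hA : A.PosDef := h.submatrix (e := Sum.inl) Sum.inl_injective
  have hAi : (A⁻¹)ᴴ = A⁻¹ := hA.isHermitian.inv
  have key : fromCols (-(Yᴴ * A⁻¹)) (1 : Matrix n n ℂ) * fromBlocks A Y Yᴴ D *
      (fromCols (-(Yᴴ * A⁻¹)) (1 : Matrix n n ℂ))ᴴ = D - Yᴴ * A⁻¹ * Y := by
    rw [fromCols_mul_fromBlocks, Matrix.neg_mul,
      nonsing_inv_mul_cancel_right _ _ (isUnit_of_posDef hA)]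
    rw [conjTranspose_fromCols_eq_fromRows_conjTranspose, fromCols_mul_fromRows]
    simp [neg_add_eq_sub]
  rw [← key]
  -- The identity block of the row makes `vecMul` injective.
  refine h.mul_mul_conjTranspose_same fun u w huw => ?_
  funext i
  have := congrFun huw (Sum.inr i)
  simpa [vecMul_fromCols] using this

end Blocks

/-- Splitting off the last block index. -/
def lastBlockEquiv (q j : ℕ) : (Fin j × Fin q) ⊕ Fin q ≃ Fin (j + 1) × Fin q :=
  Equiv.ofBijective (Sum.elim (fun x => (x.1.castSucc, x.2)) fun c => (Fin.last j, c)) <| by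
    constructor
    · rintro (⟨i, c⟩ | c) (⟨k, d⟩ | d) h <;> simp_all [Fin.ext_iff]
      · exact absurd h.1 (by have := i.2; omega)
      · exact absurd h.1 (by have := k.2; omega)
    · rintro ⟨i, c⟩
      refine Fin.lastCases ⟨Sum.inr c, rfl⟩ (fun i => ⟨Sum.inl (i, c), rfl⟩) i

@[simp] lemma lastBlockEquiv_inl {q j : ℕ} (i : Fin j) (c : Fin q) :
    lastBlockEquiv q j (Sum.inl (i, c)) = (i.castSucc, c) := rfl

@[simp] lemma lastBlockEquiv_inr {q j : ℕ} (c : Fin q) :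
    lastBlockEquiv q j (Sum.inr c) = (Fin.last j, c) := rfl

lemma gram_succ_submatrix {q j : ℕ} {f : ℕ → Matrix (Fin q) (Fin q) ℂ}
    (hH : ∀ i ≤ 2 * j, (f i).IsHermitian) :
    (gram f (j + 1)).submatrix (lastBlockEquiv q j) (lastBlockEquiv q j) =
      Matrix.fromBlocks (gram f j) (blockCol (fun i => f (j + i)) j)
        (blockCol (fun i => f (j + i)) j)ᴴ (f (2 * j)) := by
  ext x y
  rcases x with ⟨i, c⟩ | c <;> rcases y with ⟨k, d⟩ | d
  · simp [gram]
  · simp [gram, blockCol, add_comm]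
  · have : (starRingEnd ℂ) (f (j + k) d c) = f (j + k) c d :=
      congrFun (congrFun (hH (j + k) (by omega)) c) d
    simp [gram, blockCol, this]
  · simp [gram, two_mul]

lemma blockCol_succ_submatrix {q : ℕ} (e : ℕ → Matrix (Fin q) (Fin q) ℂ) (j : ℕ) :
    (blockCol e (j + 1)).submatrix (lastBlockEquiv q j) id =
      Matrix.fromRows (blockCol e j) (e j) := by
  ext x y
  rcases x with ⟨i, c⟩ | c <;> simp [blockCol]

lemma isHermitian_of_gram_posDef {q j : ℕ} {f : ℕ → Matrix (Fin q) (Fin q) ℂ}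
    (h : (gram f (j + 1)).PosDef) {i : ℕ} (hi : i ≤ 2 * j) : (f i).IsHermitian := by
  -- Any `i ≤ 2 * j` is a sum of two block indices, each at most `j`.
  have := gram_isHermitian_block h.isHermitian (⟨min i j, by omega⟩) (⟨i - min i j, by omega⟩)
  simpa [show min i j + (i - min i j) = i by omega] using this

lemma gram_posDef_of_le {q N M : ℕ} {f : ℕ → Matrix (Fin q) (Fin q) ℂ} (h : (gram f M).PosDef)
    (hNM : N ≤ M) : (gram f N).PosDef :=
  h.submatrix (e := Prod.map (Fin.castLE hNM) id)
    ((Fin.castLE_injective hNM).prodMap Function.injective_id)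

lemma schur_posDef {q j : ℕ} {f : ℕ → Matrix (Fin q) (Fin q) ℂ} (h : (gram f (j + 1)).PosDef) :
    (schur f j).PosDef := by
  apply posDef_schurComplement
  rw [← gram_succ_submatrix fun i hi => isHermitian_of_gram_posDef h hi]
  exact h.submatrix (lastBlockEquiv q j).injective

/-- Both DSM parameters are increments of such quadratic forms, so this gives each of them as a
single term. -/
lemma quadratic_inv_gram_succ {q j : ℕ} {f : ℕ → Matrix (Fin q) (Fin q) ℂ}
    (h : (gram f (j + 1)).PosDef) (e : ℕ → Matrix (Fin q) (Fin q) ℂ) :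
    (blockCol e (j + 1))ᴴ * (gram f (j + 1))⁻¹ * blockCol e (j + 1) =
      (blockCol e j)ᴴ * (gram f j)⁻¹ * blockCol e j +
        (pair e (orthPoly f j))ᴴ * (schur f j)⁻¹ * pair e (orthPoly f j) := by
  have h1 := quadratic_inv_fromBlocks (gram_posDef_of_le h (Nat.le_succ j))
    (isUnit_of_posDef (schur_posDef h)) (blockCol e j) (e j)
  rw [← gram_succ_submatrix fun i hi => isHermitian_of_gram_posDef h hi,
    ← blockCol_succ_submatrix, Matrix.inv_submatrix_equiv, Matrix.conjTranspose_submatrix,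
    Matrix.submatrix_mul_equiv, Matrix.submatrix_mul_equiv, Matrix.submatrix_id_id] at h1
  rw [h1, pair_orthPoly]
  rfl

lemma quadratic_inv_gram_zero {q : ℕ} (f e : ℕ → Matrix (Fin q) (Fin q) ℂ) :
    (blockCol e 0)ᴴ * (gram f 0)⁻¹ * blockCol e 0 = 0 := by
  ext r c
  simp [Matrix.mul_apply]

/-! ### Positivity of the Hankel matrices -/

/-- The selection matrix of a map of indices. -/
def sel {m n : Type*} [DecidableEq m] (e : n → m) : Matrix m n ℂ :=
  (1 : Matrix m m ℂ).submatrix id e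

lemma sel_mulVec_apply {m n : Type*} [DecidableEq m] [Fintype n] {e : n → m}
    (he : Function.Injective e) (x : n → ℂ) (y : n) : (sel e *ᵥ x) (e y) = x y := by
  classical
  simp [sel, Matrix.mulVec, dotProduct, Matrix.one_apply, he.eq_iff]

lemma sel_mulVec_of_notMem {m n : Type*} [DecidableEq m] [Fintype n] {e : n → m}
    (x : n → ℂ) {p : m} (hp : ∀ y, p ≠ e y) : (sel e *ᵥ x) p = 0 := by
  simp [sel, Matrix.mulVec, dotProduct, hp]

lemma sel_mul_mul_sel {m n : Type*} [DecidableEq m] [Fintype m] (e e' : n → m)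
    (M : Matrix m m ℂ) : (sel e)ᴴ * M * sel e' = M.submatrix e e' := by
  ext x y
  simp [sel, Matrix.mul_apply, Matrix.one_apply]

/-- Multiplication of vectors of coefficients by `c - X`. -/
def mulSub (q N : ℕ) (c : ℂ) : Matrix (Fin (N + 1) × Fin q) (Fin N × Fin q) ℂ :=
  c • sel (fun x => (x.1.castSucc, x.2)) - sel (fun x => (x.1.succ, x.2))

lemma mulSub_injective (q N : ℕ) (c : ℂ) : Function.Injective (mulSub q N c).mulVec := by
  have h0 : Function.Injective (fun x : Fin N × Fin q => (x.1.castSucc, x.2)) :=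
    (Fin.castSucc_injective N).prodMap Function.injective_id
  have h1 : Function.Injective (fun x : Fin N × Fin q => (x.1.succ, x.2)) :=
    (Fin.succ_injective N).prodMap Function.injective_id
  -- Block row `i + 1` of the product is `c x_{i+1} - x_i`, with `x_N` read as zero. Descending from
  -- the leading coefficient, with `d` the distance from the top, all coefficients vanish, for every
  -- `c`.
  have key : ∀ x, (mulSub q N c).mulVec x = 0 → ∀ d : ℕ, ∀ i : Fin N, (i : ℕ) + d + 1 = N →
      ∀ r, x (i, r) = 0 := by
    intro x hx d
    induction d with
    | zero =>
      intro i hi r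
      have h := congrFun hx (i.succ, r)
      rw [mulSub, Matrix.sub_mulVec, Matrix.smul_mulVec, Pi.sub_apply, Pi.smul_apply,
        sel_mulVec_apply h1 x (i, r), sel_mulVec_of_notMem] at h
      · simpa using h
      · rintro ⟨k, t⟩ h
        have := congrArg (fun p => (p.1 : ℕ)) h
        have := k.2
        simp at *
        omega
    | succ d ih =>
      intro i hi r
      have h := congrFun hx (i.succ, r)
      have e : (i.succ, r) =
          (fun x : Fin N × Fin q => (x.1.castSucc, x.2)) (⟨i + 1, by omega⟩, r) := rfl
      rw [mulSub, Matrix.sub_mulVec, Matrix.smul_mulVec, Pi.sub_apply, Pi.smul_apply,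
        sel_mulVec_apply h1 x (i, r), e, sel_mulVec_apply h0, ih _ (by simp; omega)] at h
      simpa using h
  intro x y hxy
  have h : (mulSub q N c).mulVec (x - y) = 0 := by
    rw [Matrix.mulVec_sub, sub_eq_zero]
    exact hxy
  funext ⟨i, r⟩
  exact sub_eq_zero.1 (key _ h (N - 1 - i) i (by have := i.2; omega) r)

/-- The form with weight multiplied by `(c - x)^2` is the form of `f` on multiples of `c - X`. -/
lemma gram_posDef_mul_sq {q N : ℕ} {f : ℕ → Matrix (Fin q) (Fin q) ℂ}
    (h : (gram f (N + 1)).PosDef) (c : ℝ) :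
    (gram (fun i => ((c : ℂ) * c) • f i - (2 * (c : ℂ)) • f (i + 1) + f (i + 2)) N).PosDef := by
  convert h.conjTranspose_mul_mul_same (mulSub_injective q N c) using 1
  rw [mulSub, Matrix.conjTranspose_sub, Matrix.conjTranspose_smul]
  simp only [Matrix.sub_mul, Matrix.mul_sub, Matrix.smul_mul, Matrix.mul_smul, sel_mul_mul_sel]
  ext x y
  simp only [gram, Matrix.of_apply, Matrix.sub_apply, Matrix.add_apply, Matrix.smul_apply,
    Matrix.submatrix_apply, Fin.val_castSucc, Fin.val_succ, smul_eq_mul,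
    RCLike.star_def, Complex.conj_ofReal]
  rw [show (x.1 : ℕ) + 1 + (y.1 + 1) = x.1 + y.1 + 2 by ring,
    show (x.1 : ℕ) + 1 + y.1 = x.1 + y.1 + 1 by ring, ← add_assoc]
  ring

lemma posDef_of_smul {n : Type*} [Fintype n] {M : Matrix n n ℂ} {r : ℝ} (hr : 0 < r)
    (h : ((r : ℂ) • M).PosDef) : M.PosDef := by
  have := h.smul (a := ((r : ℂ))⁻¹) (inv_pos.2 (by exact_mod_cast hr))
  rwa [smul_smul, inv_mul_cancel₀ (by exact_mod_cast hr.ne'), one_smul] at this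

/-! ### Transfer of positivity between the four moment sequences. -/

section

variable {q : ℕ} {a b : ℝ} {s : ℕ → Matrix (Fin q) (Fin q) ℂ}

/-- This is the factorization `-ab + (a+b)x - x^2 = (b-x)(x-a)`. It makes `sB b s` and `sHat a b s`
another instance of the pair `f`, `sA a f`. -/
lemma sHat_eq_sA_sB (a b : ℝ) (s : ℕ → Matrix (Fin q) (Fin q) ℂ) : sHat a b s = sA a (sB b s) := by
  funext j
  simp only [sHat, sA, sB]
  module

/-- From `(b-a)(b-x) = (b-x)(x-a) + (b-x)^2`. -/
lemma gram_sB_posDef {N : ℕ} (hab : a < b) (h1 : (gram s (N + 1)).PosDef)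
    (h2 : (gram (sHat a b s) N).PosDef) : (gram (sB b s) N).PosDef := by
  refine posDef_of_smul (sub_pos.2 hab) ?_
  convert h2.add (gram_posDef_mul_sq h1 b) using 1
  ext x y
  simp [gram, sB, sHat]
  ring

/-- From `(b-a)(x-a) = (b-x)(x-a) + (x-a)^2`. -/
lemma gram_sA_posDef {N : ℕ} (hab : a < b) (h1 : (gram s (N + 1)).PosDef)
    (h2 : (gram (sHat a b s) N).PosDef) : (gram (sA a s) N).PosDef := by
  refine posDef_of_smul (sub_pos.2 hab) ?_
  convert h2.add (gram_posDef_mul_sq h1 a) using 1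
  ext x y
  simp [gram, sA, sHat]
  ring

lemma gram_posDef_of_sA_sB {N : ℕ} (hab : a < b) (h1 : (gram (sB b s) N).PosDef)
    (h2 : (gram (sA a s) N).PosDef) : (gram s N).PosDef := by
  refine posDef_of_smul (sub_pos.2 hab) ?_
  convert h1.add h2 using 1
  ext x y
  simp [gram, sA, sB]
  ring

/-- From `(b-a)(b-x)(x-a) = (x-a)^2(b-x) + (b-x)^2(x-a)`. -/
lemma gram_sHat_posDef {N : ℕ} (hab : a < b) (h1 : (gram (sB b s) (N + 1)).PosDef)
    (h2 : (gram (sA a s) (N + 1)).PosDef) : (gram (sHat a b s) N).PosDef := by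
  refine posDef_of_smul (sub_pos.2 hab) ?_
  convert (gram_posDef_mul_sq h1 a).add (gram_posDef_mul_sq h2 b) using 1
  ext x y
  simp [gram, sA, sB, sHat]
  ring

/-! ### The matrices of a Hausdorff positive definite sequence -/

lemma HausdorffPosDef.gram {m : ℕ} (hab : a < b) (hs : HausdorffPosDef a b s m) :
    (∀ j, 2 * j ≤ m → (gram s (j + 1)).PosDef) ∧
    (∀ j, 2 * j + 1 ≤ m → (THMM.gram (sB b s) (j + 1)).PosDef) ∧
    (∀ j, 2 * j + 1 ≤ m → (THMM.gram (sA a s) (j + 1)).PosDef) ∧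
    (∀ j, 2 * j + 2 ≤ m → (THMM.gram (sHat a b s) (j + 1)).PosDef) := by
  obtain ⟨n, rfl | rfl⟩ : ∃ n, m = 2 * n ∨ m = 2 * n + 1 := ⟨m / 2, by omega⟩
  · obtain ⟨h1, h2⟩ := hs.1 n rfl
    have g1 : ∀ j, j ≤ n → (THMM.gram s (j + 1)).PosDef := fun j hj =>
      gram_posDef_of_le (M := n + 1) h1 (by omega)
    have g2 : ∀ j, j + 1 ≤ n → (THMM.gram (sHat a b s) (j + 1)).PosDef := fun j hj =>
      -- Here `j + 1 ≤ n` forces `n ≥ 1`, so the truncated subtraction is harmless.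
      gram_posDef_of_le (M := n - 1 + 1) (h2 (n - 1) (by omega)) (by omega)
    exact ⟨fun j hj => g1 j (by omega),
      fun j hj => gram_sB_posDef hab (g1 (j + 1) (by omega)) (g2 j (by omega)),
      fun j hj => gram_sA_posDef hab (g1 (j + 1) (by omega)) (g2 j (by omega)),
      fun j hj => g2 j (by omega)⟩
  · obtain ⟨h1, h2⟩ := hs.2 n rfl
    have g1 : ∀ j, j ≤ n → (THMM.gram (sB b s) (j + 1)).PosDef := fun j hj =>
      gram_posDef_of_le (M := n + 1) h1 (by omega)
    have g2 : ∀ j, j ≤ n → (THMM.gram (sA a s) (j + 1)).PosDef := fun j hj =>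
      gram_posDef_of_le (M := n + 1) h2 (by omega)
    exact ⟨fun j hj => gram_posDef_of_sA_sB hab (g1 j (by omega)) (g2 j (by omega)),
      fun j hj => g1 j (by omega), fun j hj => g2 j (by omega),
      fun j hj => gram_sHat_posDef hab (g1 (j + 1) (by omega)) (g2 (j + 1) (by omega))⟩

lemma HausdorffPosDef.isHermitian {m : ℕ} (hab : a < b) (hs : HausdorffPosDef a b s m) {i : ℕ}
    (hi : i ≤ m) : (s i).IsHermitian := by
  obtain ⟨h1, h2, -, -⟩ := hs.gram hab
  obtain ⟨n, rfl | rfl⟩ : ∃ n, i = 2 * n ∨ i = 2 * n + 1 := ⟨i / 2, by omega⟩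
  · exact isHermitian_of_gram_posDef (h1 n hi) le_rfl
  · have e0 := isHermitian_of_gram_posDef (h1 n (by omega)) le_rfl
    have e1 := isHermitian_of_gram_posDef (h2 n hi) le_rfl
    -- This may be the last moment, beyond the reach of the positive definite Hankel matrices of
    -- `s`; it is recovered from a block of `sB b s`.
    have : s (2 * n + 1) = (b : ℂ) • s (2 * n) - sB b s (2 * n) := by simp [sB]
    rw [this]
    refine Matrix.IsHermitian.sub ?_ e1
    unfold Matrix.IsHermitian at *
    simp [e0]

end

end

end THMM

namespace THMM

noncomputable section

/-! ### The resolvent of the block shift -/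

lemma T_mul_apply {q j : ℕ} {n : Type*} (M : Matrix (Fin (j + 1) × Fin q) n ℂ)
    (i : Fin j) (r : Fin q) (c : n) : (T q j * M) (i.succ, r) c = M (i.castSucc, r) c := by
  rw [Matrix.mul_apply, Finset.sum_eq_single (i.castSucc, r)]
  · simp [T]
  · rintro ⟨k, t⟩ - h
    have : ¬ ((i : ℕ) = k ∧ r = t) := fun ⟨h1, h2⟩ => h (by ext <;> simp [h1, h2])
    simp [T, this]
  · simp

lemma T_mul_apply_zero {q j : ℕ} {n : Type*} (M : Matrix (Fin (j + 1) × Fin q) n ℂ)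
    (r : Fin q) (c : n) : (T q j * M) (0, r) c = 0 := by
  simp [Matrix.mul_apply, T]

lemma isUnit_one_sub_smul_T (q j : ℕ) (z : ℂ) : IsUnit (1 - z • T q j).det := by
  have hT : IsNilpotent (T q j) := by
    refine ⟨j + 1, ?_⟩
    -- The first `k` block rows of the `k`-th power of the shift are zero.
    have : ∀ k : ℕ, ∀ i : Fin (j + 1), (i : ℕ) < k → ∀ r c, (T q j ^ k) (i, r) c = 0 := by
      intro k
      induction k with
      | zero => intro i hi; omega
      | succ k ih =>
        intro i hi r c
        rw [pow_succ']
        cases i using Fin.cases with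
        | zero => exact T_mul_apply_zero _ _ _
        | succ i =>
          rw [T_mul_apply]
          exact ih _ (by simpa using hi) _ _
    ext x y
    exact this (j + 1) x.1 x.1.2 x.2 y
  exact (Matrix.isUnit_iff_isUnit_det _).1 (hT.smul z).isUnit_one_sub

lemma R_mul_eq {q j : ℕ} {n : Type*} {z : ℂ} {M N : Matrix (Fin (j + 1) × Fin q) n ℂ}
    (h : (1 - z • T q j) * M = N) : R q j z * N = M := by
  rw [← h, R, ← Matrix.mul_assoc, Matrix.nonsing_inv_mul _ (isUnit_one_sub_smul_T q j z),
    Matrix.one_mul]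

lemma R_mul_v (q j : ℕ) (z : ℂ) :
    R q j z * v q j = blockCol (fun i => z ^ i • 1) (j + 1) := by
  refine R_mul_eq ?_
  rw [Matrix.sub_mul, Matrix.one_mul, Matrix.smul_mul]
  ext ⟨i, r⟩ c
  rw [Matrix.sub_apply, Matrix.smul_apply]
  cases i using Fin.cases with
  | zero => simp [T_mul_apply_zero, blockCol, v]
  | succ i => simp [T_mul_apply, blockCol, v, pow_succ']; ring

/-- The column `ut2 a f` is `-(1 - aT)` applied to the column of `f`, so the resolvent at the same
point `a` undoes it. -/
lemma R_mul_ut2 {q : ℕ} (a : ℝ) (f : ℕ → Matrix (Fin q) (Fin q) ℂ) (j : ℕ) :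
    R q j a * ut2 a f j = -blockCol f (j + 1) := by
  refine R_mul_eq ?_
  rw [Matrix.sub_mul, Matrix.one_mul, Matrix.smul_mul]
  ext ⟨i, r⟩ c
  rw [Matrix.sub_apply, Matrix.smul_apply]
  cases i using Fin.cases with
  | zero => simp [T_mul_apply_zero, blockCol, ut2]
  | succ i => simp [T_mul_apply, blockCol, ut2]

variable {q : ℕ} {a b : ℝ} {s : ℕ → Matrix (Fin q) (Fin q) ℂ}

/-- Since `ŝ_{i-1} = (sB b s)_i - a (sB b s)_{i-1}`, the column in `Q2` at `a` has the form of the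
one in `Theta2`, with `sB b s` as moments. -/
lemma u2_add_eq_ut2 (a b : ℝ) (s : ℕ → Matrix (Fin q) (Fin q) ℂ) (j : ℕ) :
    u2 a b s j + (a : ℂ) • (v q j * s 0) = ut2 a (sB b s) j := by
  have hv : v q j * s 0 = blockCol (fun i => if i = 0 then s 0 else 0) (j + 1) := by
    ext ⟨i, r⟩ c
    by_cases hi : i = 0 <;> simp [Matrix.mul_apply, v, blockCol, hi, Matrix.one_apply]
  rw [hv]
  ext ⟨i, r⟩ c
  cases i using Fin.cases with
  | zero => simp [blockCol, u2, ut2, sB]; ring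
  | succ i => simp [blockCol, u2, ut2, sB, sHat]; ring

/-! ### The Schur complements and polynomials in terms of orthogonal polynomials -/

lemma hatH1_eq_schur (s : ℕ → Matrix (Fin q) (Fin q) ℂ) (j : ℕ) : hatH1 s j = schur s j := by
  cases j with
  | zero => exact (schur_zero s).symm
  | succ j => rfl

lemma hatH2_eq_schur (a b : ℝ) (s : ℕ → Matrix (Fin q) (Fin q) ℂ) (j : ℕ) :
    hatH2 a b s j = schur (sHat a b s) j := by
  cases j with
  | zero => exact (schur_zero _).symm
  | succ j => rfl

lemma hatK1_eq_schur (b : ℝ) (s : ℕ → Matrix (Fin q) (Fin q) ℂ) (j : ℕ) :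
    hatK1 b s j = schur (sB b s) j := by
  cases j with
  | zero => exact (schur_zero _).symm
  | succ j => rfl

lemma hatK2_eq_schur (a : ℝ) (s : ℕ → Matrix (Fin q) (Fin q) ℂ) (j : ℕ) :
    hatK2 a s j = schur (sA a s) j := by
  cases j with
  | zero => exact (schur_zero _).symm
  | succ j => rfl

lemma P1_eq_pair (s : ℕ → Matrix (Fin q) (Fin q) ℂ) (j : ℕ) (z : ℂ) :
    P1 s j z = pair (fun i => z ^ i • 1) (orthPoly s j) := by
  cases j with
  | zero => rw [orthPoly_zero, pair_monomial]; simp [P1]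
  | succ j => rw [pair_orthPoly_eq_rowI, ← R_mul_v, ← Matrix.mul_assoc]; rfl

lemma Gamma1_eq_pair (b : ℝ) (s : ℕ → Matrix (Fin q) (Fin q) ℂ) (j : ℕ) (z : ℂ) :
    Gamma1 b s j z = pair (fun i => z ^ i • 1) (orthPoly (sB b s) j) := by
  cases j with
  | zero => rw [orthPoly_zero, pair_monomial]; simp [Gamma1]
  | succ j => rw [pair_orthPoly_eq_rowI, ← R_mul_v, ← Matrix.mul_assoc]; rfl

lemma Theta2_eq_pair (a : ℝ) (s : ℕ → Matrix (Fin q) (Fin q) ℂ) (j : ℕ) :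
    Theta2 a s j a = -pair s (orthPoly (sA a s) j) := by
  cases j with
  | zero => rw [orthPoly_zero, pair_monomial]; simp [Theta2]
  | succ j =>
    rw [pair_orthPoly_eq_rowI, ← Matrix.mul_neg, ← R_mul_ut2, ← Matrix.mul_assoc]; rfl

lemma Q2_eq_pair (a b : ℝ) (s : ℕ → Matrix (Fin q) (Fin q) ℂ) (j : ℕ) :
    Q2 a b s j a = pair (sB b s) (orthPoly (sHat a b s) j) := by
  cases j with
  | zero =>
    simp only [Q2, orthPoly_zero, pair_monomial, one_mul, sB]
    module
  | succ j =>
    rw [Q2, u2_add_eq_ut2, Matrix.mul_assoc, R_mul_ut2, Matrix.mul_neg, neg_neg,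
      pair_orthPoly_eq_rowI]
    rfl

lemma dsmT_eq_quadratic (a b : ℝ) (s : ℕ → Matrix (Fin q) (Fin q) ℂ) (j : ℕ) :
    dsmT a b s j = (blockCol (fun i => (a : ℂ) ^ i • (1 : Matrix (Fin q) (Fin q) ℂ)) (j + 1))ᴴ *
      (gram (sB b s) (j + 1))⁻¹ *
      blockCol (fun i => (a : ℂ) ^ i • (1 : Matrix (Fin q) (Fin q) ℂ)) (j + 1) := by
  rw [← R_mul_v, Matrix.conjTranspose_mul, ← Matrix.mul_assoc, dsmT]
  rfl

lemma dsmG_eq_quadratic (a b : ℝ) (hs : (s 0).IsHermitian) (j : ℕ) :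
    dsmG a b s j = (blockCol (sB b s) (j + 1))ᴴ * (gram (sHat a b s) (j + 1))⁻¹ *
      blockCol (sB b s) (j + 1) := by
  have h : (u2 a b s j)ᴴ + (a : ℂ) • (s 0 * (v q j)ᴴ) =
      (u2 a b s j + (a : ℂ) • (v q j * s 0))ᴴ := by
    rw [Matrix.conjTranspose_add, Matrix.conjTranspose_smul, Matrix.conjTranspose_mul, hs.eq]
    simp
  have h' : blockCol (sB b s) (j + 1) = -(R q j a * ut2 a (sB b s) j) := by
    rw [R_mul_ut2, neg_neg]
  rw [dsmG, h, u2_add_eq_ut2, h', Matrix.conjTranspose_neg, Matrix.conjTranspose_mul]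
  simp only [Matrix.neg_mul, Matrix.mul_neg, neg_neg, Matrix.mul_assoc]
  rfl

lemma dsmM_eq {j : ℕ} (h : (gram (sB b s) (j + 1)).PosDef) :
    dsmM a b s j = (Gamma1 b s j a)ᴴ * (hatK1 b s j)⁻¹ * Gamma1 b s j a := by
  have key := quadratic_inv_gram_succ h (fun i => (a : ℂ) ^ i • 1)
  rw [Gamma1_eq_pair, hatK1_eq_schur]
  cases j with
  | zero => rw [dsmM, dsmT_eq_quadratic, key, quadratic_inv_gram_zero, zero_add]
  | succ j =>
    rw [dsmM, dsmT_eq_quadratic, dsmT_eq_quadratic, key, add_sub_cancel_left]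

lemma dsmL_eq {j : ℕ} (hs : (s 0).IsHermitian) (h : (gram (sHat a b s) (j + 1)).PosDef) :
    dsmL a b s j = (Q2 a b s j a)ᴴ * (hatH2 a b s j)⁻¹ * Q2 a b s j a := by
  have key := quadratic_inv_gram_succ h (sB b s)
  rw [Q2_eq_pair, hatH2_eq_schur]
  cases j with
  | zero => rw [dsmL, dsmG_eq_quadratic a b hs, key, quadratic_inv_gram_zero, zero_add]
  | succ j =>
    rw [dsmL, dsmG_eq_quadratic a b hs, dsmG_eq_quadratic a b hs, key, add_sub_cancel_left]

/-! ### Ordered products -/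

lemma prodLeft_zero (A : ℕ → Matrix (Fin q) (Fin q) ℂ) : prodLeft A 0 = 1 := rfl

lemma prodLeft_succ (A : ℕ → Matrix (Fin q) (Fin q) ℂ) (N : ℕ) :
    prodLeft A (N + 1) = A N * prodLeft A N := by
  simp [prodLeft, List.range_succ]

lemma prodRight_conjTranspose (A : ℕ → Matrix (Fin q) (Fin q) ℂ) (N : ℕ) :
    prodRight (fun k => (A k)ᴴ) N = (prodLeft A N)ᴴ := by
  induction N with
  | zero => simp [prodLeft, prodRight]
  | succ N ih => simp [prodLeft_succ, ← ih, prodRight, List.range_succ]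

lemma prodRight_one (A : ℕ → Matrix (Fin q) (Fin q) ℂ) : prodRight A 1 = A 0 := by
  simp [prodRight]

lemma prodLeft_one (A : ℕ → Matrix (Fin q) (Fin q) ℂ) : prodLeft A 1 = A 0 := by
  simp [prodLeft]

section Products

variable {h κ : ℕ → Matrix (Fin q) (Fin q) ℂ}

/-- The adjoint of `h⁻¹ κ` is `κ h⁻¹`, the inverse of `h κ⁻¹`, and taking adjoints reverses the
order; the product cancels from the inside out. -/
lemma prodLeft_mul_conjTranspose {N : ℕ} (hh : ∀ k < N, (h k).PosDef)
    (hκ : ∀ k < N, (κ k).PosDef) :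
    prodLeft (fun k => h k * (κ k)⁻¹) N * (prodLeft (fun k => (h k)⁻¹ * κ k) N)ᴴ = 1 := by
  induction N with
  | zero => simp [prodLeft_zero]
  | succ N ih =>
    have h1 := hh N (Nat.lt_succ_self N)
    have h2 := hκ N (Nat.lt_succ_self N)
    have i1 : ((h N)⁻¹)ᴴ = (h N)⁻¹ := h1.isHermitian.inv
    have ih := ih (fun k hk => hh k (by omega)) (fun k hk => hκ k (by omega))
    rw [prodLeft_succ, prodLeft_succ, Matrix.conjTranspose_mul, Matrix.conjTranspose_mul, i1,
      h2.isHermitian.eq]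
    calc _ = h N * (κ N)⁻¹ * (prodLeft (fun k => h k * (κ k)⁻¹) N *
          (prodLeft (fun k => (h k)⁻¹ * κ k) N)ᴴ) * (κ N * (h N)⁻¹) := by
          simp only [Matrix.mul_assoc]
      _ = h N * ((κ N)⁻¹ * κ N) * (h N)⁻¹ := by
          rw [ih, Matrix.mul_one]
          simp only [Matrix.mul_assoc]
      _ = 1 := by
          rw [Matrix.nonsing_inv_mul _ (isUnit_of_posDef h2), Matrix.mul_one,
            Matrix.mul_nonsing_inv _ (isUnit_of_posDef h1)]

/-- The product of two consecutive parameters, with the parameters written through `h` and `κ`. -/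
lemma parameter_mul {k : ℕ} (hh : ∀ i < k + 1, (h i).PosDef) (hκ : ∀ i < k + 1, (κ i).PosDef) :
    (prodLeft (fun i => h i * (κ i)⁻¹) k)ᴴ * (κ k)⁻¹ * prodLeft (fun i => h i * (κ i)⁻¹) k *
      ((prodLeft (fun i => (h i)⁻¹ * κ i) (k + 1))ᴴ * h k *
        prodLeft (fun i => (h i)⁻¹ * κ i) (k + 1)) =
      (prodLeft (fun i => (h i)⁻¹ * κ i) k)⁻¹ * prodLeft (fun i => (h i)⁻¹ * κ i) (k + 1) := by
  have h1 := hh k (Nat.lt_succ_self k)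
  have h2 := hκ k (Nat.lt_succ_self k)
  have i1 : ((h k)⁻¹)ᴴ = (h k)⁻¹ := h1.isHermitian.inv
  have e := prodLeft_mul_conjTranspose (N := k) (fun i hi => hh i (by omega))
    (fun i hi => hκ i (by omega))
  have e' : (prodLeft (fun i => (h i)⁻¹ * κ i) k)⁻¹ =
      (prodLeft (fun i => h i * (κ i)⁻¹) k)ᴴ := by
    refine Matrix.inv_eq_left_inv ?_
    rw [← Matrix.conjTranspose_conjTranspose (prodLeft (fun i => (h i)⁻¹ * κ i) k),
      ← Matrix.conjTranspose_mul, mul_eq_one_comm.1 e, Matrix.conjTranspose_one]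
  -- Peeling off the last factor puts the two mutually inverse products of length `k` side by side.
  have e2 : (prodLeft (fun i => (h i)⁻¹ * κ i) (k + 1))ᴴ =
      (prodLeft (fun i => (h i)⁻¹ * κ i) k)ᴴ * (κ k * (h k)⁻¹) := by
    rw [prodLeft_succ, Matrix.conjTranspose_mul, Matrix.conjTranspose_mul, i1, h2.isHermitian.eq]
  rw [e', e2]
  generalize prodLeft (fun i => (h i)⁻¹ * κ i) (k + 1) = Ψ'
  generalize prodLeft (fun i => (h i)⁻¹ * κ i) k = Ψ at *
  generalize prodLeft (fun i => h i * (κ i)⁻¹) k = Φ at *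
  calc _ = Φᴴ * (κ k)⁻¹ * (Φ * Ψᴴ) * κ k * ((h k)⁻¹ * h k) * Ψ' := by
        simp only [Matrix.mul_assoc]
    _ = Φᴴ * ((κ k)⁻¹ * κ k) * Ψ' := by
        rw [e, Matrix.nonsing_inv_mul _ (isUnit_of_posDef h1), Matrix.mul_one, Matrix.mul_one]
        simp only [Matrix.mul_assoc]
    _ = Φᴴ * Ψ' := by
        rw [Matrix.nonsing_inv_mul _ (isUnit_of_posDef h2), Matrix.mul_one]

lemma isUnit_prodLeft_det {A : ℕ → Matrix (Fin q) (Fin q) ℂ} {N : ℕ}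
    (hA : ∀ k < N, IsUnit (A k).det) : IsUnit (prodLeft A N).det := by
  induction N with
  | zero => simp [prodLeft_zero]
  | succ N ih =>
    rw [prodLeft_succ, Matrix.det_mul]
    exact (hA N (Nat.lt_succ_self N)).mul (ih fun k hk => hA k (by omega))

/-- A telescoping ordered product. -/
lemma prodLeft_telescope {A Ψ : ℕ → Matrix (Fin q) (Fin q) ℂ} {N : ℕ} (h0 : Ψ 0 = 1)
    (hΨ : ∀ k < N, IsUnit (Ψ k).det) (hA : ∀ k < N, A k = (Ψ k)⁻¹ * Ψ (k + 1)) :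
    prodLeft (fun k => (A k)⁻¹) N = (Ψ N)⁻¹ := by
  induction N with
  | zero => simp [prodLeft_zero, h0]
  | succ N ih =>
    have hu := hΨ N (Nat.lt_succ_self N)
    rw [prodLeft_succ, ih (fun k hk => hΨ k (by omega)) (fun k hk => hA k (by omega)),
      hA N (Nat.lt_succ_self N), Matrix.mul_inv_rev, Matrix.nonsing_inv_nonsing_inv _ hu,
      Matrix.mul_assoc, Matrix.mul_nonsing_inv _ hu, Matrix.mul_one]

end Products

/-! ### Values at the left end point -/

lemma isUnit_gram_of_succ {f : ℕ → Matrix (Fin q) (Fin q) ℂ} {j : ℕ}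
    (h : (gram f (j + 1)).PosDef) : IsUnit (gram f j) :=
  (gram_posDef_of_le h (Nat.le_succ j)).isUnit

lemma pair_pow_orthPoly_eq {f : ℕ → Matrix (Fin q) (Fin q) ℂ} {j : ℕ}
    (hf : ∀ k < j, (gram f (k + 1)).PosDef) (hg : ∀ k < j, (gram (sA a f) (k + 1)).PosDef)
    (hH : ∀ i < 2 * j, (f i).IsHermitian) :
    pair (fun i => (a : ℂ) ^ i • 1) (orthPoly f j) =
      (-1 : ℂ) ^ j • prodLeft (fun k => schur (sA a f) k * (schur f k)⁻¹) j := by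
  induction j with
  | zero => rw [orthPoly_zero, pair_monomial]; simp [prodLeft_zero]
  | succ j ih =>
    have h1 := hf j (Nat.lt_succ_self j)
    have h2 := hg j (Nat.lt_succ_self j)
    rw [pair_pow_orthPoly_succ a (isUnit_gram_of_succ h1) h1.isUnit (isUnit_gram_of_succ h2)
      (schur_posDef h1).isUnit (fun i hi => hH i (by omega)),
      ih (fun k hk => hf k (by omega)) (fun k hk => hg k (by omega)) (fun i hi => hH i (by omega)),
      prodLeft_succ, Matrix.mul_smul, pow_succ, mul_neg_one, neg_smul]

lemma pair_orthPoly_sA_eq {f : ℕ → Matrix (Fin q) (Fin q) ℂ} {j : ℕ}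
    (hf : ∀ k ≤ j, (gram f (k + 1)).PosDef) (hg : ∀ k < j, (gram (sA a f) (k + 1)).PosDef)
    (hg' : IsUnit (gram (sA a f) j)) (hH : ∀ i < 2 * j + 1, (f i).IsHermitian) :
    pair f (orthPoly (sA a f) j) =
      (-1 : ℂ) ^ j • (schur f j * prodLeft (fun k => (schur (sA a f) k)⁻¹ * schur f k) j) := by
  induction j with
  | zero => rw [orthPoly_zero, pair_monomial]; simp [prodLeft_zero, schur_zero]
  | succ j ih =>
    have h1 := hf j (Nat.le_succ j)
    have h2 := hg j (Nat.lt_succ_self j)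
    rw [pair_orthPoly_sA_succ a h1.isUnit (isUnit_gram_of_succ h2) hg'
      (schur_posDef h2).isUnit (fun i hi => hH i (by omega)),
      ih (fun k hk => hf k (by omega)) (fun k hk => hg k (by omega)) (isUnit_gram_of_succ h2)
        (fun i hi => hH i (by omega)),
      prodLeft_succ, Matrix.mul_smul, pow_succ, mul_neg_one, neg_smul]
    simp only [Matrix.mul_assoc]

end

end THMM

namespace THMM

noncomputable section

variable {q : ℕ} {a b : ℝ} {s : ℕ → Matrix (Fin q) (Fin q) ℂ} {m : ℕ}

/-! ### The product formulas for Hausdorff positive definite sequences. -/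

namespace HausdorffPosDef

lemma isHermitian_sB (hab : a < b) (hs : HausdorffPosDef a b s m) {i : ℕ} (hi : i + 1 ≤ m) :
    (sB b s i).IsHermitian :=
  THMM.isHermitian_sB b (hs.isHermitian hab (by omega)) (hs.isHermitian hab hi)

lemma hatH1_posDef (hab : a < b) (hs : HausdorffPosDef a b s m) {j : ℕ} (hj : 2 * j ≤ m) :
    (hatH1 s j).PosDef := by
  rw [hatH1_eq_schur]
  exact schur_posDef ((hs.gram hab).1 j hj)

lemma hatK1_posDef (hab : a < b) (hs : HausdorffPosDef a b s m) {j : ℕ} (hj : 2 * j + 1 ≤ m) :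
    (hatK1 b s j).PosDef := by
  rw [hatK1_eq_schur]
  exact schur_posDef ((hs.gram hab).2.1 j hj)

lemma hatK2_posDef (hab : a < b) (hs : HausdorffPosDef a b s m) {j : ℕ} (hj : 2 * j + 1 ≤ m) :
    (hatK2 a s j).PosDef := by
  rw [hatK2_eq_schur]
  exact schur_posDef ((hs.gram hab).2.2.1 j hj)

lemma hatH2_posDef (hab : a < b) (hs : HausdorffPosDef a b s m) {j : ℕ} (hj : 2 * j + 2 ≤ m) :
    (hatH2 a b s j).PosDef := by
  rw [hatH2_eq_schur]
  exact schur_posDef ((hs.gram hab).2.2.2 j hj)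

/-- Only Schur complements of index below `j` enter, hence moments up to `2j - 1`; this explains the
bound `m + 1`. -/
lemma P1_eq (hab : a < b) (hs : HausdorffPosDef a b s m) {j : ℕ} (hj : 2 * j ≤ m + 1) :
    P1 s j a = (-1 : ℂ) ^ j • prodLeft (fun k => hatK2 a s k * (hatH1 s k)⁻¹) j := by
  obtain ⟨h1, -, h3, -⟩ := hs.gram hab
  simp only [hatK2_eq_schur, hatH1_eq_schur]
  rw [P1_eq_pair]
  exact pair_pow_orthPoly_eq (fun k hk => h1 k (by omega)) (fun k hk => h3 k (by omega))
    fun i hi => hs.isHermitian hab (by omega)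

lemma Gamma1_eq (hab : a < b) (hs : HausdorffPosDef a b s m) {j : ℕ} (hj : 2 * j ≤ m) :
    Gamma1 b s j a = (-1 : ℂ) ^ j • prodLeft (fun k => hatH2 a b s k * (hatK1 b s k)⁻¹) j := by
  obtain ⟨-, h2, -, h4⟩ := hs.gram hab
  simp only [hatH2_eq_schur, hatK1_eq_schur]
  rw [sHat_eq_sA_sB] at h4 ⊢
  rw [Gamma1_eq_pair]
  exact pair_pow_orthPoly_eq (fun k hk => h2 k (by omega)) (fun k hk => h4 k (by omega))
    fun i hi => hs.isHermitian_sB hab (by omega)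

lemma Theta2_eq (hab : a < b) (hs : HausdorffPosDef a b s m) {j : ℕ} (hj : 2 * j ≤ m) :
    Theta2 a s j a = (-1 : ℂ) ^ (j + 1) •
      (hatH1 s j * prodLeft (fun k => (hatK2 a s k)⁻¹ * hatH1 s k) j) := by
  obtain ⟨h1, -, h3, -⟩ := hs.gram hab
  simp only [hatK2_eq_schur, hatH1_eq_schur]
  rw [Theta2_eq_pair, pow_succ, mul_neg_one, neg_smul]
  congr 1
  refine pair_orthPoly_sA_eq (fun k hk => h1 k (by omega)) (fun k hk => h3 k (by omega)) ?_
    fun i hi => hs.isHermitian hab (by omega)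
  cases j with
  | zero => exact (Matrix.isUnit_iff_isUnit_det _).2 (by simp)
  | succ j => exact (h3 j (by omega)).isUnit

lemma Q2_eq (hab : a < b) (hs : HausdorffPosDef a b s m) {j : ℕ} (hj : 2 * j + 1 ≤ m) :
    Q2 a b s j a = (-1 : ℂ) ^ j •
      (hatK1 b s j * prodLeft (fun k => (hatH2 a b s k)⁻¹ * hatK1 b s k) j) := by
  obtain ⟨-, h2, -, h4⟩ := hs.gram hab
  simp only [hatH2_eq_schur, hatK1_eq_schur]
  rw [Q2_eq_pair]
  rw [sHat_eq_sA_sB] at h4 ⊢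
  refine pair_orthPoly_sA_eq (fun k hk => h2 k (by omega)) (fun k hk => h4 k (by omega)) ?_
    fun i hi => hs.isHermitian_sB hab (by omega)
  cases j with
  | zero => exact (Matrix.isUnit_iff_isUnit_det _).2 (by simp)
  | succ j => exact (h4 j (by omega)).isUnit

lemma dsmM_eq_prod (hab : a < b) (hs : HausdorffPosDef a b s m) {j : ℕ} (hj : 2 * j + 1 ≤ m) :
    dsmM a b s j = (prodLeft (fun k => hatH2 a b s k * (hatK1 b s k)⁻¹) j)ᴴ *
      (hatK1 b s j)⁻¹ * prodLeft (fun k => hatH2 a b s k * (hatK1 b s k)⁻¹) j := by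
  rw [dsmM_eq ((hs.gram hab).2.1 j hj), hs.Gamma1_eq hab (by omega)]
  simp [Matrix.conjTranspose_smul, smul_smul, ← mul_pow]

lemma dsmL_eq_prod (hab : a < b) (hs : HausdorffPosDef a b s m) {j : ℕ} (hj : 2 * j + 2 ≤ m) :
    dsmL a b s j = (prodLeft (fun k => (hatH2 a b s k)⁻¹ * hatK1 b s k) (j + 1))ᴴ *
      hatH2 a b s j * prodLeft (fun k => (hatH2 a b s k)⁻¹ * hatK1 b s k) (j + 1) := by
  have h1 := hs.hatH2_posDef hab hj
  have i1 : ((hatH2 a b s j)⁻¹)ᴴ = (hatH2 a b s j)⁻¹ := h1.isHermitian.inv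
  rw [dsmL_eq (hs.isHermitian hab (Nat.zero_le m)) ((hs.gram hab).2.2.2 j hj),
    hs.Q2_eq hab (by omega), prodLeft_succ, Matrix.mul_assoc ((hatH2 a b s j)⁻¹)]
  generalize hatK1 b s j * prodLeft (fun k => (hatH2 a b s k)⁻¹ * hatK1 b s k) j = Z
  -- Rewriting `Z^* H⁻¹ Z` as `(H⁻¹ Z)^* H (H⁻¹ Z)` absorbs one more factor, so the products include
  -- index `j`.
  rw [Matrix.conjTranspose_mul, i1, Matrix.mul_assoc Zᴴ,
    Matrix.nonsing_inv_mul _ (isUnit_of_posDef h1), Matrix.mul_one]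
  simp [Matrix.conjTranspose_smul, smul_smul, ← mul_pow, Matrix.mul_assoc]

lemma isUnit_det_prodLeft_hatH2_mul (hab : a < b) (hs : HausdorffPosDef a b s m) {j : ℕ}
    (hj : 2 * j ≤ m) :
    IsUnit (prodLeft (fun k => hatH2 a b s k * (hatK1 b s k)⁻¹) j).det := by
  refine isUnit_prodLeft_det fun k hk => ?_
  rw [Matrix.det_mul]
  exact (isUnit_of_posDef (hs.hatH2_posDef hab (by omega))).mul
    (isUnit_of_posDef (hs.hatK1_posDef hab (by omega)).inv)

lemma isUnit_det_prodLeft_hatH2_inv_mul (hab : a < b) (hs : HausdorffPosDef a b s m) {j : ℕ}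
    (hj : 2 * j ≤ m) :
    IsUnit (prodLeft (fun k => (hatH2 a b s k)⁻¹ * hatK1 b s k) j).det := by
  refine isUnit_prodLeft_det fun k hk => ?_
  rw [Matrix.det_mul]
  exact (isUnit_of_posDef (hs.hatH2_posDef hab (by omega)).inv).mul
    (isUnit_of_posDef (hs.hatK1_posDef hab (by omega)))

lemma dsmM_posDef (hab : a < b) (hs : HausdorffPosDef a b s m) {j : ℕ} (hj : 2 * j + 1 ≤ m) :
    (dsmM a b s j).PosDef := by
  rw [hs.dsmM_eq_prod hab hj]
  exact (hs.hatK1_posDef hab hj).inv.conjTranspose_mul_mul_same (Matrix.mulVec_injective_of_isUnit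
    ((Matrix.isUnit_iff_isUnit_det _).2 (hs.isUnit_det_prodLeft_hatH2_mul hab (by omega))))

lemma dsmL_posDef (hab : a < b) (hs : HausdorffPosDef a b s m) {j : ℕ} (hj : 2 * j + 2 ≤ m) :
    (dsmL a b s j).PosDef := by
  rw [hs.dsmL_eq_prod hab hj]
  exact (hs.hatH2_posDef hab hj).conjTranspose_mul_mul_same (Matrix.mulVec_injective_of_isUnit
    ((Matrix.isUnit_iff_isUnit_det _).2 (hs.isUnit_det_prodLeft_hatH2_inv_mul hab (by omega))))

lemma prodLeft_dsm_inv (hab : a < b) (hs : HausdorffPosDef a b s m) {j : ℕ} (hj : 2 * j ≤ m) :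
    prodLeft (fun k => (dsmM a b s k * dsmL a b s k)⁻¹) j =
      (prodLeft (fun k => (hatH2 a b s k)⁻¹ * hatK1 b s k) j)⁻¹ := by
  refine prodLeft_telescope (A := fun k => dsmM a b s k * dsmL a b s k)
    (Ψ := prodLeft fun k => (hatH2 a b s k)⁻¹ * hatK1 b s k) (prodLeft_zero _)
    (fun k hk => hs.isUnit_det_prodLeft_hatH2_inv_mul hab (by omega)) fun k hk => ?_
  rw [hs.dsmM_eq_prod hab (by omega), hs.dsmL_eq_prod hab (by omega)]
  exact parameter_mul (fun i hi => hs.hatH2_posDef hab (by omega))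
    fun i hi => hs.hatK1_posDef hab (by omega)

lemma hatH2_eq_prod (hab : a < b) (hs : HausdorffPosDef a b s m) {j : ℕ} (hj : 2 * j + 2 ≤ m) :
    hatH2 a b s j =
      prodRight (fun k => ((dsmM a b s k * dsmL a b s k)⁻¹)ᴴ) (j + 1) * dsmL a b s j *
        prodLeft (fun k => (dsmM a b s k * dsmL a b s k)⁻¹) (j + 1) := by
  have hu := hs.isUnit_det_prodLeft_hatH2_inv_mul hab (j := j + 1) (by omega)
  rw [prodRight_conjTranspose, hs.prodLeft_dsm_inv hab (by omega), hs.dsmL_eq_prod hab hj]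
  generalize prodLeft (fun k => (hatH2 a b s k)⁻¹ * hatK1 b s k) (j + 1) = Ψ at *
  calc _ = (Ψ * Ψ⁻¹)ᴴ * hatH2 a b s j * (Ψ * Ψ⁻¹) := by
        rw [Matrix.mul_nonsing_inv _ hu]
        simp
    _ = _ := by
        rw [Matrix.conjTranspose_mul]
        simp only [Matrix.mul_assoc]

lemma hatK1_eq_prod (hab : a < b) (hs : HausdorffPosDef a b s m) {j : ℕ} (hj : 2 * j + 1 ≤ m) :
    hatK1 b s j =
      prodRight (fun k => ((dsmM a b s k * dsmL a b s k)⁻¹)ᴴ) j * (dsmM a b s j)⁻¹ *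
        prodLeft (fun k => (dsmM a b s k * dsmL a b s k)⁻¹) j := by
  have e := prodLeft_mul_conjTranspose (N := j) (h := hatH2 a b s) (κ := hatK1 b s)
    (fun i hi => hs.hatH2_posDef hab (by omega)) (fun i hi => hs.hatK1_posDef hab (by omega))
  have hK := hs.hatK1_posDef hab hj
  have hu := hs.isUnit_det_prodLeft_hatH2_mul hab (j := j) (by omega)
  rw [prodRight_conjTranspose, hs.prodLeft_dsm_inv hab (by omega), hs.dsmM_eq_prod hab hj]
  generalize prodLeft (fun k => (hatH2 a b s k)⁻¹ * hatK1 b s k) j = Ψ at *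
  generalize prodLeft (fun k => hatH2 a b s k * (hatK1 b s k)⁻¹) j = Φ at *
  -- The outer products become `Φ` and `Φ^*`, exactly what cancels the inverses coming from `𝐦_j⁻¹`.
  have e1 : Ψ⁻¹ = Φᴴ := Matrix.inv_eq_left_inv <| by
    rw [← Matrix.conjTranspose_conjTranspose Ψ, ← Matrix.conjTranspose_mul,
      mul_eq_one_comm.1 e, Matrix.conjTranspose_one]
  have hu' : IsUnit (Φᴴ).det := by
    rw [Matrix.det_conjTranspose]
    exact hu.star
  rw [e1, Matrix.conjTranspose_conjTranspose, Matrix.mul_inv_rev, Matrix.mul_inv_rev,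
    Matrix.nonsing_inv_nonsing_inv _ (isUnit_of_posDef hK)]
  calc _ = (Φ * Φ⁻¹) * hatK1 b s j * ((Φᴴ)⁻¹ * Φᴴ) := by
        rw [Matrix.mul_nonsing_inv _ hu, Matrix.nonsing_inv_mul _ hu', Matrix.one_mul,
          Matrix.mul_one]
    _ = _ := by simp only [Matrix.mul_assoc]

end HausdorffPosDef

end

end THMM

theorem mainTheorem7 (q : ℕ) (a b : ℝ) (hab : a < b) (m : ℕ)
    (s : ℕ → Matrix (Fin q) (Fin q) ℂ) (hs : THMM.HausdorffPosDef a b s m) :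
    -- every matrix that is inverted in the definitions or in the identities is positive definite
    (∀ j : ℕ, 2 * j ≤ m → (THMM.H1 s j).PosDef ∧ (THMM.hatH1 s j).PosDef) ∧
    (∀ j : ℕ, 2 * j + 1 ≤ m →
      (THMM.K1 b s j).PosDef ∧ (THMM.K2 a s j).PosDef ∧
      (THMM.hatK1 b s j).PosDef ∧ (THMM.hatK2 a s j).PosDef ∧ (THMM.dsmM a b s j).PosDef) ∧
    (∀ j : ℕ, 2 * j + 2 ≤ m →
      (THMM.H2 a b s j).PosDef ∧ (THMM.hatH2 a b s j).PosDef ∧ (THMM.dsmL a b s j).PosDef) ∧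
    -- the Schur complements in terms of the parameters
    (2 ≤ m → THMM.hatH2 a b s 0 =
      ((THMM.dsmM a b s 0 * THMM.dsmL a b s 0)⁻¹)ᴴ * THMM.dsmL a b s 0 *
        (THMM.dsmM a b s 0 * THMM.dsmL a b s 0)⁻¹) ∧
    (1 ≤ m → THMM.hatK1 b s 0 = (THMM.dsmM a b s 0)⁻¹) ∧
    (∀ j : ℕ, 2 * j + 2 ≤ m → THMM.hatH2 a b s j =
      THMM.prodRight (fun k => ((THMM.dsmM a b s k * THMM.dsmL a b s k)⁻¹)ᴴ) (j + 1) *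
        THMM.dsmL a b s j *
        THMM.prodLeft (fun k => (THMM.dsmM a b s k * THMM.dsmL a b s k)⁻¹) (j + 1)) ∧
    (∀ j : ℕ, 2 * j + 1 ≤ m → THMM.hatK1 b s j =
      THMM.prodRight (fun k => ((THMM.dsmM a b s k * THMM.dsmL a b s k)⁻¹)ᴴ) j *
        (THMM.dsmM a b s j)⁻¹ *
        THMM.prodLeft (fun k => (THMM.dsmM a b s k * THMM.dsmL a b s k)⁻¹) j) ∧
    -- the values of the polynomials at `a` as alternating products of Schur complements
    (∀ j : ℕ, 2 * j ≤ m + 1 → THMM.P1 s j a =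
      (-1 : ℂ) ^ j • THMM.prodLeft (fun k => THMM.hatK2 a s k * (THMM.hatH1 s k)⁻¹) j) ∧
    (∀ j : ℕ, 2 * j ≤ m → THMM.Gamma1 b s j a =
      (-1 : ℂ) ^ j • THMM.prodLeft (fun k => THMM.hatH2 a b s k * (THMM.hatK1 b s k)⁻¹) j) ∧
    (∀ j : ℕ, 2 * j + 1 ≤ m → THMM.Q2 a b s j a =
      (-1 : ℂ) ^ j • (THMM.hatK1 b s j *
        THMM.prodLeft (fun k => (THMM.hatH2 a b s k)⁻¹ * THMM.hatK1 b s k) j)) ∧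
    (∀ j : ℕ, 2 * j ≤ m → THMM.Theta2 a s j a =
      (-1 : ℂ) ^ (j + 1) • (THMM.hatH1 s j *
        THMM.prodLeft (fun k => (THMM.hatK2 a s k)⁻¹ * THMM.hatH1 s k) j)) ∧
    -- the parameters in terms of the Schur complements
    (1 ≤ m → THMM.dsmM a b s 0 = (THMM.hatK1 b s 0)⁻¹) ∧
    (2 ≤ m → THMM.dsmL a b s 0 =
      ((THMM.hatH2 a b s 0)⁻¹ * THMM.hatK1 b s 0)ᴴ * THMM.hatH2 a b s 0 *
        ((THMM.hatH2 a b s 0)⁻¹ * THMM.hatK1 b s 0)) ∧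
    (∀ j : ℕ, 2 * j + 1 ≤ m → THMM.dsmM a b s j =
      THMM.prodRight (fun k => (THMM.hatH2 a b s k * (THMM.hatK1 b s k)⁻¹)ᴴ) j *
        (THMM.hatK1 b s j)⁻¹ *
        THMM.prodLeft (fun k => THMM.hatH2 a b s k * (THMM.hatK1 b s k)⁻¹) j) ∧
    (∀ j : ℕ, 2 * j + 2 ≤ m → THMM.dsmL a b s j =
      THMM.prodRight (fun k => ((THMM.hatH2 a b s k)⁻¹ * THMM.hatK1 b s k)ᴴ) (j + 1) *
        THMM.hatH2 a b s j *
        THMM.prodLeft (fun k => (THMM.hatH2 a b s k)⁻¹ * THMM.hatK1 b s k) (j + 1)) := by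

  obtain ⟨h1, h2, h3, h4⟩ := hs.gram hab
  refine ⟨fun j hj => ⟨h1 j hj, hs.hatH1_posDef hab hj⟩,
    fun j hj => ⟨h2 j hj, h3 j hj, hs.hatK1_posDef hab hj, hs.hatK2_posDef hab hj,
      hs.dsmM_posDef hab hj⟩,
    fun j hj => ⟨h4 j hj, hs.hatH2_posDef hab hj, hs.dsmL_posDef hab hj⟩,
    fun h => ?_, fun h => ?_, fun j hj => hs.hatH2_eq_prod hab hj,
    fun j hj => hs.hatK1_eq_prod hab hj, fun j hj => hs.P1_eq hab hj,
    fun j hj => hs.Gamma1_eq hab hj, fun j hj => hs.Q2_eq hab hj,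
    fun j hj => hs.Theta2_eq hab hj, fun h => ?_, fun h => ?_, fun j hj => ?_, fun j hj => ?_⟩
  · simpa only [zero_add, THMM.prodRight_one, THMM.prodLeft_one] using hs.hatH2_eq_prod hab (j := 0) h
  · simpa [THMM.prodRight, THMM.prodLeft] using hs.hatK1_eq_prod hab (j := 0) h
  · simpa [THMM.prodLeft] using hs.dsmM_eq_prod hab (j := 0) h
  · simpa only [zero_add, THMM.prodLeft_one] using hs.dsmL_eq_prod hab (j := 0) h
  · rw [THMM.prodRight_conjTranspose]
    exact hs.dsmM_eq_prod hab hj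
  · rw [THMM.prodRight_conjTranspose]
    exact hs.dsmL_eq_prod hab hj
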